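/- Let $\mathbb K$ be a field of characteristic zero and let $H_{CK}$ be the Connes–Kreimer Hopf algebra over $\mathbb K$: it has the rooted forests as a basis, its product is the disjoint union of forests, and its coproduct $\Delta$, multiplicative, is given on trees by $\Delta(B(x))=1\otimes B(x)+(B\otimes \mathrm{Id})\Delta(x)$, where $B$ joins the roots of a forest to a new root. Let $S$ be its antipode. For two forests $F,G$ put $F\bullet G=\sum_{v}F\bullet_v G$, the sum over the vertices $v$ of $F$, where $F\bullet_v G$ is obtained from $FG$ by adding an edge from $v$ to every root of $G$; extend $\bullet$ bilinearly. Let $\delta_1$ be the tree with one vertex and $\delta_{n}=\delta_{n-1}\bullet\delta_1$ for $n\ge 2$. For a finite sequence $(i_2,\ldots,i_n)$ of nonnegative integers let $\omega(i_2,\ldots,i_n)=1i_2+\cdots+(n-1)i_n-1$ be its weight, and let $\partial(i_2,\ldots,i_n)$ be the sequence obtained by deleting its trailing zeros. A sequence is dominant if it is nonempty and its last entry is nonzero. For every dominant sequence $(i_2,\ldots,i_n)$ of weight $N\ge 1$ define $P_{i_2,\ldots,i_n}\in\mathbb Z[X_1,\ldots,X_N]$ inductively by $P_2=(X_1-2)(X_1-1)$,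 $P_{0,1}=X_1-1$ (the two sequences of weight $1$) and, for $N\ge 2$, $$P_{i_2,\ldots,i_n}=\sum_{j\ge 3,\ i_j\ge 1}(i_{j-1}+1)\,P_{\partial(i_2,\ldots,i_{j-1}+1,i_j-1,\ldots,i_n)}+\delta_{i_2\ge 1}\,(X_N-2i_2-\cdots-ni_n+2)\,P_{\partial(i_2-1,i_3,\ldots,i_n)},$$ where $\delta_{i_2\ge1}$ is $1$ if $i_2\ge 1$ and $0$ otherwise (in which case the second term is absent). Theorem. For every $n\ge 1$ there is a unique family of coefficients $a_{i_1,\ldots,i_n}\in\mathbb K$, indexed by the $(i_1,\ldots,i_n)\in\mathbb N^n$ with $1i_1+\cdots+ni_n=n$, such that $$S(\delta_n)=\sum_{1i_1+\cdots+ni_n=n}a_{i_1,\ldots,i_n}\,\delta_1^{i_1}\cdots\delta_n^{i_n}.$$ Moreover, for every such $(i_1,\ldots,i_n)$ for which $N=\omega(i_2,\ldots,i_n)\ge 1$, $$a_{i_1,\ldots,i_n}=(-1)^{i_1+\cdots+i_n}(n-1)!\sum_{1\le p_1<\cdots<p_N\le n-1}\frac{P_{\partial(i_2,\ldots,i_n)}(p_1,\ldots,p_N)}{p_1\cdots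 p_N}.$$ -/

import Mathlib

/-- Finite rooted trees with an ordering of the children of each vertex. -/
inductive PlanarTree : Type
  | node (n : ℕ) (c : Fin n → PlanarTree) : PlanarTree

namespace PlanarTree
/-- Isomorphism of rooted trees (the order of the children is forgotten): a bijection between the
children of the roots under which corresponding subtrees are isomorphic. -/
inductive Iso : PlanarTree → PlanarTree → Prop
  | node {m n : ℕ} (c : Fin m → PlanarTree) (d : Fin n → PlanarTree) (σ : Fin m ≃ Fin n)
      (h : ∀ k, Iso (c k) (d (σ k))) : Iso (node m c) (node n d)

theorem Iso.refl (t : PlanarTree) : Iso t t := by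
  induction t with
  | node n c ih => exact .node c c (Equiv.refl _) ih

theorem Iso.symm {t u : PlanarTree} (h : Iso t u) : Iso u t := by
  induction h with
  | node c d σ _ ih => exact .node d c σ.symm fun k => by simpa using ih (σ.symm k)

theorem Iso.trans {t u v : PlanarTree} (h : Iso t u) (h' : Iso u v) : Iso t v := by
  induction h generalizing v with
  | node c d σ _ ih =>
    cases h' with
    | node _ e τ h' => exact .node c e (σ.trans τ) fun k => ih k (h' (σ k))

instance setoid : Setoid PlanarTree := ⟨Iso, Iso.refl, Iso.symm, Iso.trans⟩

/-- Evaluation of a tree from the leaves to the root. -/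
def fold {α : Type*} (f : Multiset α → α) : PlanarTree → α
  | node _ c => f (Finset.univ.val.map fun k => fold f (c k))

theorem fold_eq_of_iso {α : Type*} (f : Multiset α → α) {t u : PlanarTree} (h : Iso t u) :
    fold f t = fold f u := by
  induction h with
  | node c d σ _ ih =>
    simp only [fold]
    congr 1
    have : (Finset.univ.val.map σ : Multiset _) = Finset.univ.val :=
      congrArg Finset.val (Finset.map_univ_equiv σ)
    rw [← this, Multiset.map_map]
    exact Multiset.map_congr rfl fun k _ => ih k
end PlanarTree

theorem map_univ_get_toList {α : Type*} (s : Multiset α) :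
    (Finset.univ.val.map fun k => s.toList.get k) = s := by
  rw [Fin.univ_val_map, List.ofFn_get, Multiset.coe_toList]

theorem exists_equiv_of_map_univ_eq {α : Type*} {m n : ℕ} (f : Fin m → α) (g : Fin n → α)
    (h : (Finset.univ.val.map f : Multiset α) = Finset.univ.val.map g) :
    ∃ σ : Fin m ≃ Fin n, ∀ k, g (σ k) = f k := by
  classical
  have key : ∀ a, Nonempty ({k // f k = a} ≃ {k // g k = a}) := by
    intro a
    rw [← Fintype.card_eq, Fintype.card_subtype, Fintype.card_subtype]
    have := congrArg (Multiset.count a) h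
    simp only [Multiset.count_map, eq_comm (a := a)] at this
    exact this
  let e := fun a => (key a).some
  refine ⟨(Equiv.sigmaFiberEquiv f).symm.trans ((Equiv.sigmaCongrRight e).trans
    (Equiv.sigmaFiberEquiv g)), fun k => ?_⟩
  exact (e (f k) ⟨k, rfl⟩).2

/-- Isomorphism classes of finite (nonempty) rooted trees. A rooted forest is a
`Multiset RTree`. -/
def RTree : Type := Quotient PlanarTree.setoid

namespace RTree

noncomputable instance : DecidableEq RTree := Classical.decEq _

/-- The rooted tree obtained by joining all the roots of a forest to a new root. -/
noncomputable def node (s : Multiset RTree) : RTree :=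
  Quotient.mk _ (.node s.toList.length fun k => (s.toList.get k).out)

theorem node_map_mk {n : ℕ} (c : Fin n → PlanarTree) :
    node (Finset.univ.val.map fun k => (Quotient.mk _ (c k) : RTree)) =
      Quotient.mk _ (.node n c) := by
  set s : Multiset RTree := Finset.univ.val.map fun k => (Quotient.mk _ (c k) : RTree)
    with hs
  have h1 := map_univ_get_toList s
  obtain ⟨σ, hσ⟩ := exists_equiv_of_map_univ_eq _ _ (h1.trans hs)
  refine Quotient.sound (.node _ _ σ fun k => ?_)
  refine Quotient.exact (s := PlanarTree.setoid) ?_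

  exact (Quotient.out_eq _).trans (hσ k).symm

/-- Every rooted tree is `node s` for the forest `s` of its branches: induction principle. -/
theorem ind {P : RTree → Prop} (h : ∀ s, (∀ t ∈ s, P t) → P (node s)) (t : RTree) :
    P t := by
  induction t using Quotient.inductionOn with
  | h t =>
    induction t with
    | node n c ih =>
      rw [← node_map_mk]
      refine h _ fun t ht => ?_
      obtain ⟨k, -, rfl⟩ := Multiset.mem_map.1 ht
      exact ih k

def fold {α : Type*} (f : Multiset α → α) : RTree → α :=
  Quotient.lift (PlanarTree.fold f) fun _ _ => PlanarTree.fold_eq_of_iso f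

theorem fold_node {α : Type*} (f : Multiset α → α) (s : Multiset RTree) :
    fold f (node s) = f (s.map (fold f)) := by
  have h1 := map_univ_get_toList s
  conv_rhs => rw [← h1, Multiset.map_map]
  change f _ = f _
  congr 1
  refine Multiset.map_congr rfl fun k _ => ?_
  change _ = fold f (s.toList.get k)
  conv_rhs => rw [← Quotient.out_eq (s.toList.get k)]
  rfl

/-- Recursion on rooted trees: the value at `node s` is computed from the branches of the tree
and from the values at the branches, see `recTree_node`. -/
noncomputable def recTree {α : Type*} (f : Multiset (RTree × α) → α) (t : RTree) : α :=
  (fold (fun u : Multiset (RTree × α) => (node (u.map Prod.fst), f u)) t).2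

theorem recTree_node {α : Type*} (f : Multiset (RTree × α) → α) (s : Multiset RTree) :
    recTree f (node s) = f (s.map fun t => (t, recTree f t)) := by
  have key : ∀ t, (fold (fun u : Multiset (RTree × α) => (node (u.map Prod.fst), f u)) t).1
      = t := by
    refine ind fun s ih => ?_
    rw [fold_node, Multiset.map_map]
    simp only
    congr 1
    exact (Multiset.map_congr rfl ih).trans (Multiset.map_id' s)
  rw [recTree, fold_node]
  simp only
  congr 1
  exact Multiset.map_congr rfl fun t _ => Prod.ext (key t) rfl

theorem node_injective : Function.Injective node := by
  have h := recTree_node (fun u : Multiset (RTree × Multiset RTree) => u.map Prod.fst)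
  intro s t hst
  have := h s
  rw [hst, h t] at this
  simpa [Multiset.map_map, Function.comp_def] using this.symm
end RTree

section Hopf
open scoped TensorProduct

/-- The Connes-Kreimer algebra: the free commutative algebra on the rooted trees. Its monomials
are the rooted forests, and its product is the disjoint union of forests. -/
def ConnesKreimer (K : Type*) [CommRing K] : Type _ := MvPolynomial RTree K

namespace ConnesKreimer

variable {K : Type*} [CommRing K]

noncomputable instance : CommRing (ConnesKreimer K) :=
  inferInstanceAs (CommRing (MvPolynomial RTree K))

noncomputable instance : Algebra K (ConnesKreimer K) :=
  inferInstanceAs (Algebra K (MvPolynomial RTree K))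

/-- A rooted tree, as an element of the algebra. -/
noncomputable def tree (t : RTree) : ConnesKreimer K := (MvPolynomial.X t : MvPolynomial RTree K)

/-- A rooted forest, as an element of the algebra. -/
noncomputable def forest (F : Multiset RTree) : ConnesKreimer K := (F.map tree).prod

/-- The universal property of the free commutative algebra. -/
noncomputable def lift {A : Type*} [CommRing A] [Algebra K A] (f : RTree → A) :
    ConnesKreimer K →ₐ[K] A :=
  (MvPolynomial.aeval f : MvPolynomial RTree K →ₐ[K] A)

theorem lift_tree {A : Type*} [CommRing A] [Algebra K A] (f : RTree → A) (t : RTree) :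
    lift (K := K) f (tree t) = f t :=
  MvPolynomial.aeval_X (R := K) f t

theorem algHom_ext {A : Type*} [CommRing A] [Algebra K A] {f g : ConnesKreimer K →ₐ[K] A}
    (h : ∀ t, f (tree t) = g (tree t)) : f = g :=
  MvPolynomial.algHom_ext (σ := RTree) (R := K) h

theorem map_forest {A : Type*} [CommRing A] [Algebra K A] (f : ConnesKreimer K →ₐ[K] A)
    (F : Multiset RTree) : f (forest F) = (F.map fun t => f (tree t)).prod := by
  rw [forest, map_multiset_prod, Multiset.map_map]; rfl

/-- The basis of rooted forests. -/
noncomputable def forestBasis : Module.Basis (Multiset RTree) K (ConnesKreimer K) :=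
  (MvPolynomial.basisMonomials RTree K).reindex Multiset.toFinsupp.symm.toEquiv

theorem forestBasis_apply (F : Multiset RTree) : forestBasis (K := K) F = forest F := by
  have h : forestBasis (K := K) F = MvPolynomial.monomial (R := K) (Multiset.toFinsupp F) 1 :=
    (Module.Basis.reindex_apply (MvPolynomial.basisMonomials RTree K) _ _).trans
      (congrFun (MvPolynomial.coe_basisMonomials RTree K) _)
  rw [h, MvPolynomial.monomial_eq]
  simp only [map_one, one_mul]
  rw [Finsupp.prod, forest, Finset.prod_multiset_map_count]
  simp only [Multiset.toFinsupp_support, Multiset.toFinsupp_apply]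
  rfl

theorem linearMap_ext {M : Type*} [AddCommMonoid M] [Module K M] {f g : ConnesKreimer K →ₗ[K] M}
    (h : ∀ F, f (forest F) = g (forest F)) : f = g :=
  forestBasis.ext fun F => by rw [forestBasis_apply]; exact h F

/-- The grafting operator `B`: a forest is sent to the tree obtained by joining all its roots to
a new root. -/
noncomputable def bPlus : ConnesKreimer K →ₗ[K] ConnesKreimer K :=
  forestBasis.constr K fun F => tree (RTree.node F)

theorem bPlus_forest (F : Multiset RTree) :
    bPlus (forest F) = (tree (RTree.node F) : ConnesKreimer K) := by
  rw [bPlus, ← forestBasis_apply, Module.Basis.constr_basis]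

/-- The coproduct on trees, which separates a tree into a lower part (on the left) and an upper
part (on the right): `Δ (B x) = 1 ⊗ B x + (B ⊗ Id) (Δ x)`, see also `comulHom_bPlus`. -/
noncomputable def comulTree : RTree → ConnesKreimer K ⊗[K] ConnesKreimer K :=
  RTree.recTree fun u => 1 ⊗ₜ tree (RTree.node (u.map Prod.fst)) +
    TensorProduct.map bPlus LinearMap.id (u.map Prod.snd).prod

/-- The coproduct, extended multiplicatively to forests. -/
noncomputable def comulHom : ConnesKreimer K →ₐ[K] ConnesKreimer K ⊗[K] ConnesKreimer K :=
  lift comulTree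

/-- The counit, which vanishes on nonempty forests. -/
noncomputable def counitHom : ConnesKreimer K →ₐ[K] K := lift fun _ => 0

/-- Simultaneous recursion for `S t` (first component) and `(Id ⊗ S) (Δ t)` (second component),
the value of `S (B x)` being `- m ((B ⊗ Id) ((Id ⊗ S) (Δ x)))`. -/
noncomputable def antipodeRec :
    RTree → ConnesKreimer K × (ConnesKreimer K ⊗[K] ConnesKreimer K) :=
  RTree.recTree fun u =>
    let Q := TensorProduct.map bPlus LinearMap.id (u.map fun p => p.2.2).prod
    (-LinearMap.mul' K _ Q, Q - 1 ⊗ₜ LinearMap.mul' K _ Q)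

theorem antipodeRec_node (s : Multiset RTree) : antipodeRec (K := K) (RTree.node s) =
    (-LinearMap.mul' K _ (TensorProduct.map bPlus LinearMap.id
        (s.map fun t => (antipodeRec t).2).prod),
      TensorProduct.map bPlus LinearMap.id (s.map fun t => (antipodeRec t).2).prod -
        1 ⊗ₜ LinearMap.mul' K _ (TensorProduct.map bPlus LinearMap.id
          (s.map fun t => (antipodeRec t).2).prod)) := by
  rw [antipodeRec, RTree.recTree_node]
  simp only [Multiset.map_map, Function.comp_def]

/-- The antipode on trees. -/
noncomputable def antipodeTree (t : RTree) : ConnesKreimer K := (antipodeRec t).1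

/-- The antipode, extended multiplicatively to forests. The antipode axioms are
`mul_antipode_id` and `mul_id_antipode`. -/
noncomputable def antipodeHom : ConnesKreimer K →ₐ[K] ConnesKreimer K := lift antipodeTree

theorem comulHom_bPlus (x : ConnesKreimer K) :
    comulHom (bPlus x) = 1 ⊗ₜ bPlus x + TensorProduct.map bPlus LinearMap.id (comulHom x) := by
  have : comulHom.toLinearMap ∘ₗ bPlus = TensorProduct.mk K _ _ 1 ∘ₗ bPlus +
      TensorProduct.map bPlus LinearMap.id ∘ₗ (comulHom (K := K)).toLinearMap := by
    refine linearMap_ext fun F => ?_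
    simp only [LinearMap.comp_apply, LinearMap.add_apply, AlgHom.toLinearMap_apply, bPlus_forest,
      TensorProduct.mk_apply, map_forest]
    simp only [comulHom, lift_tree]
    rw [comulTree, RTree.recTree_node]
    simp only [Multiset.map_map, Function.comp_def, Multiset.map_id']
  exact LinearMap.congr_fun this x

theorem counitHom_bPlus (x : ConnesKreimer K) : counitHom (bPlus x) = 0 := by
  have : counitHom.toLinearMap ∘ₗ bPlus = (0 : ConnesKreimer K →ₗ[K] K) := by
    refine linearMap_ext fun F => ?_
    simp [bPlus_forest, counitHom, lift_tree]
  exact LinearMap.congr_fun this x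

/-- Induction principle for algebra maps. -/
theorem algHom_ext_bPlus {A : Type*} [CommRing A] [Algebra K A] {f g : ConnesKreimer K →ₐ[K] A}
    (h : ∀ x, f x = g x → f (bPlus x) = g (bPlus x)) : f = g := by
  refine algHom_ext fun t => ?_
  induction t using RTree.ind with
  | h s ih =>
    rw [← bPlus_forest]
    apply h
    rw [map_forest, map_forest, Multiset.map_congr rfl ih]

open Algebra.TensorProduct in
noncomputable instance : Bialgebra K (ConnesKreimer K) :=
  Bialgebra.ofAlgHom comulHom counitHom
    (by
      have h1 : ∀ (w : ConnesKreimer K ⊗[K] ConnesKreimer K) (b : ConnesKreimer K),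
          TensorProduct.assoc K _ _ _ (TensorProduct.map bPlus LinearMap.id w ⊗ₜ[K] b) =
            TensorProduct.map bPlus LinearMap.id (TensorProduct.assoc K _ _ _ (w ⊗ₜ[K] b)) := by
        intro w b
        induction w with
        | zero => simp
        | tmul x y => simp
        | add x y hx hy => simp only [map_add, TensorProduct.add_tmul, hx, hy]
      have h2 : ∀ z : ConnesKreimer K ⊗[K] ConnesKreimer K,
          TensorProduct.assoc K _ _ _ (map comulHom (.id K _)
            (TensorProduct.map bPlus LinearMap.id z)) =
          1 ⊗ₜ[K] (TensorProduct.map bPlus LinearMap.id z) +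
            TensorProduct.map bPlus LinearMap.id
              (TensorProduct.assoc K _ _ _ (map comulHom (.id K _) z)) := by
        intro z
        induction z with
        | zero => simp
        | tmul x y => simp [comulHom_bPlus, TensorProduct.add_tmul, h1]
        | add x y hx hy =>
          simp only [map_add, TensorProduct.tmul_add, hx, hy]
          abel
      have h3 : ∀ z : ConnesKreimer K ⊗[K] ConnesKreimer K,
          map (.id K _) comulHom (TensorProduct.map bPlus LinearMap.id z) =
            TensorProduct.map bPlus LinearMap.id (map (.id K _) comulHom z) := by
        intro z
        induction z with
        | zero => simp
        | tmul x y => simp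
        | add x y hx hy => simp only [map_add, hx, hy]
      refine algHom_ext_bPlus fun x hx => ?_
      have hx' : TensorProduct.assoc K _ _ _ (map comulHom (.id K _) (comulHom x)) =
        map (.id K _) comulHom (comulHom x) := hx
      change TensorProduct.assoc K _ _ _ (map comulHom (.id K _) (comulHom (bPlus x))) =
        map (.id K _) comulHom (comulHom (bPlus x))
      rw [comulHom_bPlus, map_add, map_add, map_add, h2, h3, hx']
      simp [comulHom_bPlus, TensorProduct.tmul_add, one_def, add_assoc])
    (by
      have h1 : ∀ z : ConnesKreimer K ⊗[K] ConnesKreimer K,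
          map counitHom (.id K _) (TensorProduct.map bPlus LinearMap.id z) = 0 := by
        intro z
        induction z with
        | zero => simp
        | tmul x y => simp [counitHom_bPlus]
        | add x y hx hy => simp only [map_add, hx, hy, add_zero]
      refine algHom_ext_bPlus fun x hx => ?_
      change map counitHom (.id K _) (comulHom (bPlus x)) = 1 ⊗ₜ bPlus x
      rw [comulHom_bPlus, map_add, h1]
      simp)
    (by
      have h1 : ∀ z : ConnesKreimer K ⊗[K] ConnesKreimer K,
          map (.id K _) counitHom (TensorProduct.map bPlus LinearMap.id z) =
            TensorProduct.map bPlus LinearMap.id (map (.id K _) counitHom z) := by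
        intro z
        induction z with
        | zero => simp
        | tmul x y => simp
        | add x y hx hy => simp only [map_add, hx, hy]
      refine algHom_ext_bPlus fun x hx => ?_
      have hx' : map (.id K _) counitHom (comulHom x) = x ⊗ₜ 1 := hx
      change map (.id K _) counitHom (comulHom (bPlus x)) = bPlus x ⊗ₜ 1
      rw [comulHom_bPlus, map_add, h1, hx']
      simp [counitHom_bPlus])

open Algebra.TensorProduct in
theorem map_id_antipodeHom_bPlus (z : ConnesKreimer K ⊗[K] ConnesKreimer K) :
    map (.id K _) antipodeHom (TensorProduct.map bPlus LinearMap.id z) =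
      TensorProduct.map bPlus LinearMap.id (map (.id K _) antipodeHom z) := by
  induction z with
  | zero => simp
  | tmul x y => simp
  | add x y hx hy => simp only [map_add, hx, hy]

theorem antipodeRec_snd (t : RTree) :
    (antipodeRec (K := K) t).2 =
      Algebra.TensorProduct.map (.id K _) antipodeHom (comulHom (tree t)) := by
  induction t using RTree.ind with
  | h s ih =>
    rw [← bPlus_forest, comulHom_bPlus, map_add, map_id_antipodeHom_bPlus, bPlus_forest,
      map_forest, map_multiset_prod, Multiset.map_map]
    simp only [Function.comp_def, Algebra.TensorProduct.map_tmul, map_one, antipodeHom, lift_tree]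
    rw [← antipodeHom, antipodeTree, antipodeRec_node]
    rw [Multiset.map_congr rfl ih]
    simp only [TensorProduct.tmul_neg]
    abel

theorem antipodeHom_bPlus (x : ConnesKreimer K) :
    antipodeHom (bPlus x) = -LinearMap.mul' K _ (TensorProduct.map bPlus LinearMap.id
      (Algebra.TensorProduct.map (.id K _) antipodeHom (comulHom x))) := by
  have : antipodeHom.toLinearMap ∘ₗ bPlus = -(LinearMap.mul' K _ ∘ₗ
      TensorProduct.map bPlus LinearMap.id ∘ₗ
      (Algebra.TensorProduct.map (.id K _) antipodeHom).toLinearMap ∘ₗ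
      (comulHom (K := K)).toLinearMap) := by
    refine linearMap_ext fun F => ?_
    simp only [LinearMap.comp_apply, LinearMap.neg_apply, AlgHom.toLinearMap_apply, bPlus_forest,
      map_forest, map_multiset_prod, Multiset.map_map, Function.comp_def, ← antipodeRec_snd]
    rw [antipodeHom, lift_tree, antipodeTree, antipodeRec_node]
  exact LinearMap.congr_fun this x

open Algebra.TensorProduct in
theorem mul_id_antipode (x : ConnesKreimer K) :
    lmul' K (map (.id K _) antipodeHom (comulHom x)) =
      algebraMap K (ConnesKreimer K) (counitHom x) := by
  have : (lmul' K).comp ((map (.id K _) antipodeHom).comp comulHom) =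
      (Algebra.ofId K (ConnesKreimer K)).comp counitHom := by
    refine algHom_ext_bPlus fun x _ => ?_
    change lmul' K (map (.id K _) antipodeHom (comulHom (bPlus x))) =
      algebraMap K (ConnesKreimer K) (counitHom (bPlus x))
    rw [comulHom_bPlus, map_add, map_id_antipodeHom_bPlus, counitHom_bPlus, map_zero, map_add,
      map_tmul, antipodeHom_bPlus]
    simp only [map_one, lmul'_apply_tmul, one_mul]
    exact neg_add_cancel _
  exact DFunLike.congr_fun this x

open Algebra.TensorProduct in
theorem mul_antipode_id (x : ConnesKreimer K) :
    lmul' K (map antipodeHom (.id K _) (comulHom x)) =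
      algebraMap K (ConnesKreimer K) (counitHom x) := by
  let c : ConnesKreimer K →ₐ[K] ConnesKreimer K :=
    (lmul' K).comp ((map antipodeHom (.id K _)).comp comulHom)
  have h1 : ∀ (w : ConnesKreimer K ⊗[K] ConnesKreimer K) (b : ConnesKreimer K),
      LinearMap.mul' K _ (TensorProduct.map bPlus LinearMap.id
        (map (.id K _) antipodeHom w)) * b =
      LinearMap.mul' K _ (TensorProduct.map bPlus LinearMap.id
        (map (.id K _) ((lmul' K).comp (map antipodeHom (.id K _)))
          (TensorProduct.assoc K _ _ _ (w ⊗ₜ[K] b)))) := by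
    intro w b
    induction w with
    | zero => simp
    | tmul x y => simp [mul_assoc]
    | add x y hx hy => simp only [map_add, TensorProduct.add_tmul, add_mul, hx, hy]
  have h2 : ∀ z : ConnesKreimer K ⊗[K] ConnesKreimer K,
      lmul' K (map antipodeHom (.id K _) (TensorProduct.map bPlus LinearMap.id z)) =
      -LinearMap.mul' K _ (TensorProduct.map bPlus LinearMap.id
        (map (.id K _) ((lmul' K).comp (map antipodeHom (.id K _)))
          (TensorProduct.assoc K _ _ _ (map comulHom (.id K _) z)))) := by
    intro z
    induction z with
    | zero => simp
    | tmul x y =>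
      rw [TensorProduct.map_tmul, map_tmul, lmul'_apply_tmul, antipodeHom_bPlus, neg_mul, h1]
      rfl
    | add x y hx hy =>
      simp only [map_add, hx, hy]
      abel
  have h3 : ∀ z : ConnesKreimer K ⊗[K] ConnesKreimer K,
      map (.id K _) c (TensorProduct.map bPlus LinearMap.id z) =
        TensorProduct.map bPlus LinearMap.id (map (.id K _) c z) := by
    intro z
    induction z with
    | zero => simp
    | tmul x y => simp
    | add x y hx hy => simp only [map_add, hx, hy]
  have h4 : (map (.id K _) c).comp comulHom = includeLeft (R := K) (S := K) := by
    refine algHom_ext_bPlus fun x hx => ?_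
    have hx' : map (.id K _) c (comulHom x) = x ⊗ₜ 1 := hx
    have hc : c (bPlus x) = 0 := by
      change lmul' K (map antipodeHom (.id K _) (comulHom (bPlus x))) = 0
      have hco : TensorProduct.assoc K _ _ _ (map comulHom (.id K _) (comulHom x)) =
        map (.id K _) comulHom (comulHom x) := Coalgebra.coassoc_apply (R := K) x
      have hcc : map (.id K _) ((lmul' K).comp (map antipodeHom (.id K _)))
          (map (.id K _) comulHom (comulHom x)) = map (.id K _) c (comulHom x) := by
        rw [← AlgHom.comp_apply, ← map_comp]
        rfl
      rw [comulHom_bPlus, map_add, map_add, h2, hco, hcc, hx']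
      simp
    change map (.id K _) c (comulHom (bPlus x)) = bPlus x ⊗ₜ 1
    rw [comulHom_bPlus, map_add, h3, hx', map_tmul, hc]
    simp
  have h5 : ∀ z : ConnesKreimer K ⊗[K] ConnesKreimer K,
      c (TensorProduct.lid K _ (map counitHom (.id K _) z)) =
        TensorProduct.lid K _ (map counitHom (.id K _) (map (.id K _) c z)) := by
    intro z
    induction z with
    | zero => simp
    | tmul x y => simp
    | add x y hx hy => simp only [map_add, hx, hy]
  have h6 : map counitHom (.id K _) (comulHom x) = 1 ⊗ₜ x :=
    Coalgebra.rTensor_counit_comul (R := K) x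
  have h7 := h5 (comulHom x)
  rw [h6] at h7
  have h8 : map (.id K _) c (comulHom x) = x ⊗ₜ 1 := DFunLike.congr_fun h4 x
  rw [h8] at h7
  change c x = _
  simpa [Algebra.algebraMap_eq_smul_one] using h7

noncomputable instance : HopfAlgebra K (ConnesKreimer K) where
  antipode := antipodeHom.toLinearMap
  mul_antipode_rTensor_comul := LinearMap.ext fun x => mul_antipode_id x
  mul_antipode_lTensor_comul := LinearMap.ext fun x => mul_id_antipode x

end ConnesKreimer
end Hopf

namespace RTree
/-- The multiset of the trees obtained from `t` by joining all the roots of the forest `G` to a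
vertex `v` of `t`, one tree for each vertex `v`: either `v` is the root, or `v` lies in one of the
branches. -/
noncomputable def graftings (G : Multiset RTree) : RTree → Multiset RTree :=
  recTree fun u => node (u.map Prod.fst + G) ::ₘ
    u.bind fun p => p.2.map fun t' => node (t' ::ₘ (u.map Prod.fst).erase p.1)

/-- The multiset of the forests obtained from `F` by joining all the roots of the forest `G` to a
vertex `v` of `F`, one forest for each vertex `v`. -/
noncomputable def forestGraftings (F G : Multiset RTree) : Multiset (Multiset RTree) :=
  F.bind fun t => (graftings G t).map fun t' => t' ::ₘ F.erase t
end RTree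

namespace ConnesKreimer
variable {K : Type*} [CommRing K]

/-- The preLie product `F • G = ∑ v, F •ᵥ G` given by grafting, extended bilinearly. -/
noncomputable def preLie : ConnesKreimer K →ₗ[K] ConnesKreimer K →ₗ[K] ConnesKreimer K :=
  forestBasis.constr K fun F => forestBasis.constr K fun G =>
    ((RTree.forestGraftings F G).map forest).sum

/-- The tree with one vertex. -/
noncomputable def dot : ConnesKreimer K := tree (RTree.node 0)

/-- The Connes-Moscovici generators: `δ₁` is the tree with one vertex and `δₙ₊₁ = δₙ • δ₁`.
The value at `0` is not used. -/
noncomputable def delta : ℕ → ConnesKreimer K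
  | 0 => 0
  | 1 => dot
  | n + 2 => preLie (delta (n + 1)) dot

/-- The sequences `(i₁, …, iₙ)` with `1 i₁ + … + n iₙ = n`, where `i j` stands for `i_{j+1}`. -/
def cmIndices (n : ℕ) : Finset (Fin n → ℕ) :=
  {i ∈ Fintype.piFinset fun _ => Finset.range (n + 1) | ∑ j : Fin n, ((j : ℕ) + 1) * i j = n}

theorem mem_cmIndices {n : ℕ} {i : Fin n → ℕ} :
    i ∈ cmIndices n ↔ ∑ j : Fin n, ((j : ℕ) + 1) * i j = n := by
  simp only [cmIndices, Finset.mem_filter, Fintype.mem_piFinset, Finset.mem_range,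
    and_iff_right_iff_imp]
  intro h j
  have := Finset.single_le_sum (f := fun j : Fin n => ((j : ℕ) + 1) * i j)
    (fun _ _ => Nat.zero_le _) (Finset.mem_univ j)
  simp only [h] at this
  nlinarith

/-- `a` is a family of coefficients of the antipode of `δₙ`:
`S (δₙ) = ∑ a_{i₁, …, iₙ} δ₁ ^ i₁ ⋯ δₙ ^ iₙ`. -/
def IsAntipodeExpansion (n : ℕ) (a : cmIndices n → K) : Prop :=
  HopfAlgebra.antipode K (delta n : ConnesKreimer K) =
    ∑ i : cmIndices n, a i • ∏ j : Fin n, (delta ((j : ℕ) + 1)) ^ i.1 j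

end ConnesKreimer

/-- The dominant of a sequence: its trailing zeros are removed. -/
def dominant (l : List ℕ) : List ℕ := l.rdropWhile (· = 0)

/-- The weight of `(i₂, …, iₙ)` is `1 i₂ + … + (n - 1) iₙ - 1`; the entry `k` of the list, counted
from `0`, is `i_{k+2}`. -/
def weight (l : List ℕ) : ℤ :=
  (∑ k ∈ Finset.range l.length, ((k : ℤ) + 1) * l.getD k 0) - 1

open MvPolynomial in
/-- The polynomial `P_{i₂, …, iₙ}` in `ℤ[X₁, …, X_N]`, for a dominant sequence `l = (i₂, …, iₙ)` of
weight `N ≥ 1`. The variable `X k` stands for `X_{k+1}`, and the entry `k` of `l` for `i_{k+2}`. For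
`N ≥ 2`, the summand `k` of the sum is the one of `j = k + 3`. The values for other `N` and `l` are
not used. -/
noncomputable def iterPoly : (N : ℕ) → List ℕ → MvPolynomial (Fin N) ℤ
  | 0, _ => 0
  | 1, l => if l = [2] then (X 0 - 2) * (X 0 - 1) else if l = [0, 1] then X 0 - 1 else 0
  | N + 2, l =>
    (∑ k ∈ Finset.range l.length with 1 ≤ l.getD (k + 1) 0,
      C ((l.getD k 0 : ℤ) + 1) * rename Fin.castSucc
        (iterPoly (N + 1) (dominant ((l.set k (l.getD k 0 + 1)).set (k + 1)
          (l.getD (k + 1) 0 - 1))))) +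
    if 1 ≤ l.getD 0 0 then
      (X (Fin.last (N + 1)) - C (∑ k ∈ Finset.range l.length, ((k : ℤ) + 2) * l.getD k 0) + 2) *
        rename Fin.castSucc (iterPoly (N + 1) (dominant (l.set 0 (l.getD 0 0 - 1))))
    else 0

open Classical in
/-- The sequences of integers `1 ≤ p₁ < … < p_N ≤ m`. -/
noncomputable def increasingTuples (N m : ℕ) : Finset (Fin N → ℕ) :=
  {p ∈ Fintype.piFinset fun _ => Finset.Icc 1 m | StrictMono p}

theorem mem_increasingTuples {N m : ℕ} {p : Fin N → ℕ} :
    p ∈ increasingTuples N m ↔ (∀ k, 1 ≤ p k ∧ p k ≤ m) ∧ StrictMono p := by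
  simp [increasingTuples]

/-! Only the operator `x ↦ x • δ₁` matters, written `growth` below. It is a derivation N with `N δₙ
= δₙ₊₁`. A leaf added to a tree with a cut lies in the lower part, lies in the upper part, or hangs
on a lower vertex and is itself cut off. With D the derivation counting vertices, this gives `Δ N =
(N ⊗ 1 + 1 ⊗ N + D ⊗ δ₁·) Δ` (`comulHom_growth`). Convolution then yields `S N = N S - δ₁ · S D`
(`antipodeHom_growth`), and since D multiplies `δₙ` by n, `S(δₙ₊₁) = N(S δₙ) - n δ₁ S(δₙ)`.

So `S(δₙ₊₁)` is the value at the `δₖ` of a polynomial `antipodePoly n` defined by this recursion.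
Projecting onto corollas shows that the `δₖ` are algebraically independent (`evalDelta_injective`);
this gives uniqueness and identifies the coefficients.

By homogeneity the exponent of `δ₁` is determined by the monomial m in `δ₂, δ₃, …`. Divided by its
sign and by n!, the coefficient becomes a function c(n, m) for which c(n + 1, m) - c(n, m) is 1/(n +
1) times a combination of values c(n, m') (`normCoeff_succ`). Each m' is m with some `δⱼ`, j ≥ 3,
replaced by `δⱼ₋₁`, or with one `δ₂` removed, so its weight is one less. The iterated sums satisfy
the same relation, the largest index being p = n + 1 and the polynomials P recording the
combinations (`iterSum_succ_succ`). Equality follows by induction on the weight and on n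
(`normCoeff_listMon`). -/

namespace RTree

/-- The number of vertices of a rooted tree. -/
def size : RTree → ℕ := fold fun u => u.sum + 1

theorem size_node (s : Multiset RTree) : size (node s) = (s.map size).sum + 1 :=
  fold_node _ s

theorem graftings_node (G s : Multiset RTree) :
    graftings G (node s) = node (s + G) ::ₘ (forestGraftings s G).map node := by
  rw [graftings, recTree_node]
  simp only [Multiset.map_map, Function.comp_def, Multiset.map_id', forestGraftings,
    Multiset.bind_map, Multiset.map_bind]
  rfl

/-- The chosen vertex lies either in `a` or in `F`. This is the Leibniz rule that makes grafting a
leaf a derivation. -/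
theorem forestGraftings_cons (a : RTree) (F G : Multiset RTree) :
    forestGraftings (a ::ₘ F) G =
      (graftings G a).map (· ::ₘ F) + (forestGraftings F G).map (a ::ₘ ·) := by
  rw [forestGraftings, Multiset.cons_bind, Multiset.erase_cons_head, forestGraftings,
    Multiset.map_bind]
  congr 1
  refine Multiset.bind_congr fun t ht => ?_
  rw [Multiset.map_map]
  refine Multiset.map_congr rfl fun t' _ => ?_
  rw [Multiset.erase_cons_tail_of_mem ht, Function.comp_apply, Multiset.cons_swap]

end RTree

/-! ### Grafting a leaf, counting vertices, and their relation to coproduct and antipode -/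

namespace ConnesKreimer
open scoped TensorProduct
open TensorProduct (map)

variable {K : Type*} [CommRing K]

theorem forest_zero : forest (K := K) 0 = 1 := by simp [forest]

theorem forest_cons (t : RTree) (F : Multiset RTree) :
    forest (K := K) (t ::ₘ F) = tree t * forest F := by simp [forest]

theorem bPlus_one : bPlus (1 : ConnesKreimer K) = dot := by
  rw [← forest_zero, bPlus_forest, dot]

/-- The derivation with given values on the rooted trees. -/
noncomputable def derivation (f : RTree → ConnesKreimer K) :
    Derivation K (ConnesKreimer K) (ConnesKreimer K) :=
  (MvPolynomial.mkDerivation K f : Derivation K (MvPolynomial RTree K) (MvPolynomial RTree K))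

theorem derivation_tree (f : RTree → ConnesKreimer K) (t : RTree) :
    derivation f (tree t) = f t :=
  MvPolynomial.mkDerivation_X (R := K) (A := MvPolynomial RTree K) f t

theorem derivation_forest_cons (D : Derivation K (ConnesKreimer K) (ConnesKreimer K)) (t : RTree)
    (F : Multiset RTree) :
    D (forest (t ::ₘ F)) = tree t * D (forest F) + forest F * D (tree t) := by
  rw [forest_cons, D.leibniz, smul_eq_mul, smul_eq_mul]

/-- Two linear maps satisfying the Leibniz rule along an algebra map are equal as soon as their
equality is inherited by trees from the forests of their branches. -/
theorem leibniz_ext_bPlus {A : Type*} [CommRing A] [Algebra K A] (φ : ConnesKreimer K →ₐ[K] A)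
    {D E : ConnesKreimer K →ₗ[K] A} (hD : ∀ x y, D (x * y) = φ x * D y + φ y * D x)
    (hE : ∀ x y, E (x * y) = φ x * E y + φ y * E x)
    (h : ∀ x, D x = E x → D (bPlus x) = E (bPlus x)) : D = E := by
  have one : ∀ L : ConnesKreimer K →ₗ[K] A, (∀ x y, L (x * y) = φ x * L y + φ y * L x) →
      L 1 = 0 := by
    intro L hL
    have := hL 1 1
    simpa using this
  have key : ∀ F : Multiset RTree, (∀ t ∈ F, D (tree t) = E (tree t)) →
      D (forest F) = E (forest F) := by
    intro F
    induction F using Multiset.induction_on with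
    | empty => intro; rw [forest_zero, one D hD, one E hE]
    | cons t F ih =>
      intro hF
      rw [forest_cons, hD, hE, hF t (Multiset.mem_cons_self _ _),
        ih fun u hu => hF u (Multiset.mem_cons_of_mem hu)]
  refine linearMap_ext fun F => key F fun t _ => ?_
  clear * - key h
  induction t using RTree.ind with
  | h s ih => rw [← bPlus_forest, h _ (key s ih)]

/-- The derivation which grafts a new leaf to a tree in all possible ways. -/
noncomputable def growth : Derivation K (ConnesKreimer K) (ConnesKreimer K) :=
  derivation fun t => ((RTree.graftings {RTree.node 0} t).map tree).sum

/-- The derivation multiplying a tree by its number of vertices. -/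
noncomputable def degree : Derivation K (ConnesKreimer K) (ConnesKreimer K) :=
  derivation fun t => t.size • tree t

theorem growth_forest (F : Multiset RTree) : growth (K := K) (forest F) =
    ((RTree.forestGraftings F {RTree.node 0}).map forest).sum := by
  induction F using Multiset.induction_on with
  | empty => simp [forest_zero, RTree.forestGraftings]
  | cons t F ih =>
    rw [derivation_forest_cons, ih, growth, derivation_tree, RTree.forestGraftings_cons]
    simp only [Multiset.map_add, Multiset.sum_add, Multiset.map_map, Function.comp_def, forest_cons,
      Multiset.sum_map_mul_left, Multiset.sum_map_mul_right]
    ring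

theorem preLie_dot (x : ConnesKreimer K) : preLie x dot = growth x := by
  have : preLie.flip dot = (growth (K := K)).toLinearMap := by
    refine linearMap_ext fun F => ?_
    have h : (dot : ConnesKreimer K) = forestBasis {RTree.node 0} := by
      rw [forestBasis_apply, forest, Multiset.map_singleton, Multiset.prod_singleton, dot]
    rw [LinearMap.flip_apply, preLie, h, ← forestBasis_apply, Module.Basis.constr_basis,
      Module.Basis.constr_basis, forestBasis_apply]
    exact (growth_forest F).symm
  exact LinearMap.congr_fun this x

/-- The new leaf is attached either to a vertex of a branch or to the new root; in the second case
it becomes a further branch. -/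
theorem growth_bPlus (x : ConnesKreimer K) :
    growth (bPlus x) = bPlus (growth x) + bPlus (x * dot) := by
  have : (growth (K := K)).toLinearMap ∘ₗ bPlus = bPlus ∘ₗ (growth (K := K)).toLinearMap +
      bPlus ∘ₗ LinearMap.mulRight K dot := by
    refine linearMap_ext fun F => ?_
    have h : forest F * (dot : ConnesKreimer K) = forest (F + {RTree.node 0}) := by
      simp [forest, dot]
    simp only [LinearMap.comp_apply, LinearMap.add_apply, LinearMap.mulRight_apply,
      Derivation.coeFn_coe, h, bPlus_forest, growth_forest,
      map_multiset_sum, Multiset.map_map, Function.comp_def]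
    rw [growth, derivation_tree, RTree.graftings_node, Multiset.map_cons, Multiset.sum_cons,
      Multiset.map_map, add_comm]
    rfl
  exact LinearMap.congr_fun this x

theorem degree_forest (F : Multiset RTree) :
    degree (forest (K := K) F) = (F.map RTree.size).sum • forest F := by
  induction F using Multiset.induction_on with
  | empty => simp [forest_zero]
  | cons t F ih =>
    rw [derivation_forest_cons, ih, degree, derivation_tree, forest_cons, Multiset.map_cons,
      Multiset.sum_cons, add_smul, mul_smul_comm, mul_smul_comm, mul_comm (forest F), add_comm]

theorem degree_bPlus (x : ConnesKreimer K) :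
    degree (bPlus x) = bPlus (degree x) + bPlus x := by
  have : (degree (K := K)).toLinearMap ∘ₗ bPlus = bPlus ∘ₗ (degree (K := K)).toLinearMap +
      bPlus := by
    refine linearMap_ext fun F => ?_
    simp only [LinearMap.comp_apply, LinearMap.add_apply, Derivation.coeFn_coe, bPlus_forest, degree_forest, map_nsmul]
    rw [degree, derivation_tree, RTree.size_node, succ_nsmul]
  exact LinearMap.congr_fun this x

/-- The operator on the tensor square which corresponds to `growth` under the coproduct. -/
noncomputable def growthTensor :
    ConnesKreimer K ⊗[K] ConnesKreimer K →ₗ[K] ConnesKreimer K ⊗[K] ConnesKreimer K :=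
  map growth.toLinearMap .id + map .id growth.toLinearMap +
    map degree.toLinearMap (LinearMap.mulLeft K dot)

theorem growthTensor_tmul (x y : ConnesKreimer K) : growthTensor (x ⊗ₜ[K] y) =
    growth x ⊗ₜ y + x ⊗ₜ growth y + degree x ⊗ₜ (dot * y) := by
  simp [growthTensor]

theorem growthTensor_mul (u v : ConnesKreimer K ⊗[K] ConnesKreimer K) :
    growthTensor (u * v) = u * growthTensor v + v * growthTensor u := by
  induction u with
  | zero => simp
  | add u u' hu hu' => simp only [add_mul, map_add, mul_add, hu, hu']; abel
  | tmul x y =>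
    induction v with
    | zero => simp
    | add v v' hv hv' => simp only [add_mul, map_add, mul_add, hv, hv']; abel
    | tmul x' y' =>
      simp only [Algebra.TensorProduct.tmul_mul_tmul, growthTensor_tmul, Derivation.leibniz,
        smul_eq_mul, TensorProduct.add_tmul, TensorProduct.tmul_add, mul_add]
      rw [mul_comm x' x, mul_comm y' y, mul_left_comm y dot y', mul_left_comm y' dot y,
        mul_comm y' y]
      abel

/-- The defect of commutation with `B ⊗ Id` is multiplication by `Δ δ₁`: the summand `dot ⊗ 1` is
the leaf placed on the new root, and `1 ⊗ dot` comes from the new root being counted by `degree`. -/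
theorem growthTensor_map_bPlus (z : ConnesKreimer K ⊗[K] ConnesKreimer K) :
    growthTensor (map bPlus .id z) =
      map bPlus .id (growthTensor z + z * (1 ⊗ₜ dot + dot ⊗ₜ 1)) := by
  induction z with
  | zero => simp
  | add u v hu hv => rw [map_add, map_add, hu, hv, ← map_add, map_add growthTensor, add_mul]; abel_nf
  | tmul x y =>
    simp only [TensorProduct.map_tmul, LinearMap.id_apply, growthTensor_tmul, growth_bPlus,
      degree_bPlus, mul_add, Algebra.TensorProduct.tmul_mul_tmul, mul_one, map_add,
      TensorProduct.add_tmul, mul_comm y dot]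
    abel

theorem comulHom_dot : comulHom (dot : ConnesKreimer K) = 1 ⊗ₜ dot + dot ⊗ₜ 1 := by
  rw [← bPlus_one, comulHom_bPlus, map_one comulHom, Algebra.TensorProduct.one_def,
    TensorProduct.map_tmul, LinearMap.id_apply]

/-- Both sides obey the Leibniz rule along `comulHom`, so an induction through `bPlus` suffices. The
term with `degree` stands for the leaves attached to a lower vertex and then cut off. -/
theorem comulHom_growth (x : ConnesKreimer K) :
    comulHom (growth x) = growthTensor (comulHom x) := by
  have : comulHom.toLinearMap ∘ₗ (growth (K := K)).toLinearMap =
      growthTensor ∘ₗ (comulHom (K := K)).toLinearMap := by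
    refine leibniz_ext_bPlus comulHom ?_ ?_ ?_
    · intro x y
      simp [Derivation.leibniz]
    · intro x y
      simp [growthTensor_mul]
    · intro x hx
      replace hx : comulHom (growth x) = growthTensor (comulHom x) := hx
      change comulHom (growth (bPlus x)) = growthTensor (comulHom (bPlus x))
      rw [growth_bPlus, map_add, comulHom_bPlus, comulHom_bPlus, comulHom_bPlus, hx, map_mul comulHom,
        comulHom_dot, map_add growthTensor, growthTensor_map_bPlus, growthTensor_tmul, growth_bPlus]
      simp only [map_add, TensorProduct.tmul_add, Derivation.map_one_eq_zero,
        TensorProduct.zero_tmul]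
      abel
  exact LinearMap.congr_fun this x

/-- A linear map whose convolution product with the identity vanishes is zero. -/
theorem eq_zero_of_conv_id {L : ConnesKreimer K →ₗ[K] ConnesKreimer K}
    (h : ∀ x, LinearMap.mul' K _ (map L .id (comulHom x)) = 0) : L = 0 := by
  have h1 : WithConv.toConv L * WithConv.toConv (LinearMap.id : _ →ₗ[K] ConnesKreimer K) = 0 := by
    apply WithConv.ext
    exact LinearMap.ext h
  have h2 := congrArg (· * WithConv.toConv (HopfAlgebra.antipode K (A := ConnesKreimer K))) h1
  simp only [mul_assoc, zero_mul, LinearMap.id_mul_antipode, mul_one] at h2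
  exact congrArg WithConv.ofConv h2

/-- The difference `L` of the two sides satisfies `L * Id = 0` for convolution: by `comulHom_growth`
and the Leibniz rule, `(L * Id) x` is `ε(N x) - N(ε(x) 1)`, and both terms vanish. -/
theorem antipodeHom_growth (x : ConnesKreimer K) :
    antipodeHom (growth x) = growth (antipodeHom x) - dot * antipodeHom (degree x) := by
  let S := (antipodeHom (K := K)).toLinearMap
  let L := S ∘ₗ growth.toLinearMap - growth.toLinearMap ∘ₗ S +
    LinearMap.mulLeft K dot ∘ₗ S ∘ₗ degree.toLinearMap
  have h1 : ∀ z : ConnesKreimer K ⊗[K] ConnesKreimer K, LinearMap.mul' K _ (map L .id z) =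
      LinearMap.mul' K _ (map S .id (growthTensor z)) - growth (LinearMap.mul' K _ (map S .id z)) := by
    intro z
    induction z with
    | zero => simp
    | add u v hu hv => simp only [map_add, hu, hv]; abel
    | tmul x y =>
      simp only [growthTensor_tmul, map_add, TensorProduct.map_tmul, LinearMap.id_apply,
        LinearMap.mul'_apply, Derivation.leibniz, smul_eq_mul]
      simp only [L, LinearMap.add_apply, LinearMap.sub_apply, LinearMap.comp_apply,
        LinearMap.mulLeft_apply, Derivation.coeFn_coe]
      ring
  have h3 : ∀ x, LinearMap.mul' K _ (map S .id (comulHom x)) =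
      algebraMap K (ConnesKreimer K) (counitHom x) := mul_antipode_id
  have h4 : L = 0 := eq_zero_of_conv_id fun x => by
    have h5 : counitHom (growth x) = 0 := by
      have : counitHom.toLinearMap ∘ₗ (growth (K := K)).toLinearMap = 0 := by
        refine leibniz_ext_bPlus counitHom ?_ ?_ ?_
        · intro x y
          simp [Derivation.leibniz]
        · simp
        · intro x _
          simp [growth_bPlus, counitHom_bPlus]
      exact LinearMap.congr_fun this x
    rw [h1, ← comulHom_growth, h3, h3, h5, Derivation.map_algebraMap, map_zero, sub_zero]
  have h5 : antipodeHom (growth x) - growth (antipodeHom x) + dot * antipodeHom (degree x) = 0 :=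
    LinearMap.congr_fun h4 x
  linear_combination h5

theorem antipodeHom_dot : antipodeHom (dot : ConnesKreimer K) = -dot := by
  rw [← bPlus_one, antipodeHom_bPlus, map_one, map_one, Algebra.TensorProduct.one_def,
    TensorProduct.map_tmul, LinearMap.mul'_apply]
  simp

theorem delta_succ_succ (n : ℕ) : delta (K := K) (n + 2) = growth (delta (n + 1)) :=
  preLie_dot _

theorem degree_dot : degree (dot (K := K)) = dot := by
  rw [← bPlus_one, degree_bPlus, Derivation.map_one_eq_zero, map_zero, zero_add]

/-- Grafting a leaf adds one vertex, that is `[D, N] = N`. The commutator of two derivations is a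
derivation, so the equality can be checked through `bPlus`. -/
theorem degree_growth (x : ConnesKreimer K) :
    degree (growth x) = growth (degree x) + growth x := by
  let D : Derivation K (ConnesKreimer K) (ConnesKreimer K) :=
    ⁅(degree : Derivation K (ConnesKreimer K) (ConnesKreimer K)),
      (growth : Derivation K (ConnesKreimer K) (ConnesKreimer K))⁆
  have hD : ∀ x, D x = degree (growth x) - growth (degree x) :=
    fun x => Derivation.commutator_apply x
  have key : D.toLinearMap = growth.toLinearMap := by
    refine leibniz_ext_bPlus (AlgHom.id K _) (fun x y => D.leibniz x y)
      (fun x y => growth.leibniz x y) fun x hx => ?_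
    replace hx : D x = growth x := hx
    change D (bPlus x) = growth (bPlus x)
    rw [hD] at hx ⊢
    simp only [degree_bPlus, growth_bPlus, map_add, Derivation.leibniz, degree_dot, smul_eq_mul,
      sub_eq_iff_eq_add.1 hx, mul_comm dot]
    abel
  have : D x = growth x := LinearMap.congr_fun key x
  rw [hD] at this
  linear_combination this

theorem degree_delta (n : ℕ) : degree (delta (K := K) (n + 1)) = (n + 1) • delta (n + 1) := by
  induction n with
  | zero => rw [zero_add, one_smul]; exact degree_dot (K := K)
  | succ n ih => rw [delta_succ_succ, degree_growth, ih, map_nsmul, ← succ_nsmul]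

theorem antipodeHom_delta_succ (n : ℕ) : antipodeHom (delta (K := K) (n + 2)) =
    growth (antipodeHom (delta (n + 1))) - (n + 1) • (dot * antipodeHom (delta (n + 1))) := by
  rw [delta_succ_succ, antipodeHom_growth, degree_delta, map_nsmul, mul_smul_comm]

end ConnesKreimer

/-! ### The polynomial model and algebraic independence of the Connes-Moscovici generators -/

theorem RTree.ne_node_zero_of_mem_graftings {G : Multiset RTree} (hG : G ≠ 0) {t u : RTree}
    (h : u ∈ RTree.graftings G t) : u ≠ RTree.node 0 := by
  induction t using RTree.ind with
  | h s _ =>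
    rw [graftings_node, Multiset.mem_cons, Multiset.mem_map] at h
    rintro rfl
    rcases h with h | ⟨F, hF, h⟩
    · exact hG (add_eq_zero.1 (node_injective h).symm).2
    · simp only [forestGraftings, Multiset.mem_bind, Multiset.mem_map] at hF
      obtain ⟨t, -, t', -, rfl⟩ := hF
      exact Multiset.cons_ne_zero (node_injective h)

namespace ConnesKreimer
open MvPolynomial (X)

variable {K : Type*} [CommRing K]

/-- The derivation of the polynomial algebra which sends each variable to the next one. -/
noncomputable def shift : Derivation K (MvPolynomial ℕ K) (MvPolynomial ℕ K) :=
  MvPolynomial.mkDerivation K fun k => X (k + 1)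

/-- The polynomial expressing the antipode of `δₙ₊₁` in the Connes-Moscovici generators, the
variable `X k` standing for `δₖ₊₁`. -/
noncomputable def antipodePoly : ℕ → MvPolynomial ℕ K
  | 0 => -X 0
  | n + 1 => shift (antipodePoly n) - (n + 1) • (X 0 * antipodePoly n)

/-- Substitution of the Connes-Moscovici generators in a polynomial. -/
noncomputable def evalDelta : MvPolynomial ℕ K →ₐ[K] ConnesKreimer K :=
  MvPolynomial.aeval fun k => delta (k + 1)

theorem evalDelta_shift (p : MvPolynomial ℕ K) : evalDelta (shift p) = growth (evalDelta p) := by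
  induction p using MvPolynomial.induction_on with
  | C a =>
    rw [← MvPolynomial.algebraMap_eq, Derivation.map_algebraMap, map_zero, AlgHom.commutes,
      Derivation.map_algebraMap]
  | add p q hp hq => simp only [map_add, hp, hq]
  | mul_X p k hp =>
    have : evalDelta (shift (X k : MvPolynomial ℕ K)) = growth (evalDelta (X k)) := by
      simp [shift, evalDelta, MvPolynomial.mkDerivation_X, delta_succ_succ]
    simp only [Derivation.leibniz, map_mul, smul_eq_mul, map_add, hp, this]

theorem antipodeHom_delta (n : ℕ) :
    antipodeHom (delta (K := K) (n + 1)) = evalDelta (antipodePoly n) := by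
  induction n with
  | zero => simpa [antipodePoly, evalDelta, delta] using antipodeHom_dot (K := K)
  | succ n ih =>
    have h0 : evalDelta (X 0 : MvPolynomial ℕ K) = dot := by simp [evalDelta, delta]
    rw [antipodeHom_delta_succ, ih, antipodePoly, map_sub, map_nsmul, map_mul, evalDelta_shift, h0]

/-- The algebra map which sends the corolla with `k` leaves to the variable `X k`, and the other
trees to zero. -/
noncomputable def corollaHom : ConnesKreimer K →ₐ[K] MvPolynomial ℕ K :=
  lift (RTree.recTree fun u =>
    if u.map Prod.fst = Multiset.replicate u.card (RTree.node 0) then X u.card else 0)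

theorem corollaHom_node (s : Multiset RTree) : corollaHom (tree (K := K) (RTree.node s)) =
    if ∀ t ∈ s, t = RTree.node 0 then X s.card else 0 := by
  rw [corollaHom, lift_tree, RTree.recTree_node]
  simp [Multiset.map_map, Multiset.eq_replicate]

/-- A leaf added at the root of a corolla gives the next corolla. A leaf added elsewhere creates a
branch with more than one vertex, so the result is killed. -/
theorem corollaHom_growth_tree (t : RTree) :
    corollaHom (growth (tree (K := K) t)) = shift (corollaHom (tree t)) := by
  induction t using RTree.ind with
  | h s _ =>
    rw [growth, derivation_tree, RTree.graftings_node, Multiset.map_cons, Multiset.sum_cons,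
      map_add, map_multiset_sum, Multiset.sum_eq_zero, add_zero, corollaHom_node, corollaHom_node]
    · rw [Multiset.card_add, Multiset.card_singleton]
      by_cases h : ∀ t ∈ s, t = RTree.node 0
      · rw [if_pos h, if_pos (fun t ht => (Multiset.mem_add.1 ht).elim (h t) Multiset.mem_singleton.1), shift,
          MvPolynomial.mkDerivation_X]
      · rw [if_neg h, if_neg (fun h' => h fun t ht => h' t (Multiset.mem_add.2 (Or.inl ht))), map_zero]
    · intro x hx
      simp only [RTree.forestGraftings, Multiset.mem_map, Multiset.mem_bind] at hx
      obtain ⟨_, ⟨_, ⟨F, ⟨t, -, t', ht', rfl⟩, rfl⟩, rfl⟩, rfl⟩ := hx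
      rw [corollaHom_node, if_neg]
      exact fun h => RTree.ne_node_zero_of_mem_graftings (Multiset.singleton_ne_zero _) ht'
        (h t' (Multiset.mem_cons_self _ _))

theorem corollaHom_growth (x : ConnesKreimer K) :
    corollaHom (growth x) = shift (corollaHom x) := by
  have : corollaHom.toLinearMap ∘ₗ (growth (K := K)).toLinearMap =
      (shift (K := K)).toLinearMap ∘ₗ (corollaHom (K := K)).toLinearMap := by
    refine leibniz_ext_bPlus corollaHom ?_ ?_ ?_
    · simp [Derivation.leibniz]
    · simp [Derivation.leibniz]
    · intro x _
      suffices corollaHom.toLinearMap ∘ₗ (growth (K := K)).toLinearMap ∘ₗ bPlus =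
        (shift (K := K)).toLinearMap ∘ₗ (corollaHom (K := K)).toLinearMap ∘ₗ bPlus from
        LinearMap.congr_fun this x
      refine linearMap_ext fun F => ?_
      simp only [LinearMap.comp_apply, bPlus_forest]
      exact corollaHom_growth_tree _
  exact LinearMap.congr_fun this x

theorem corollaHom_delta (n : ℕ) : corollaHom (delta (K := K) (n + 1)) = X n := by
  induction n with
  | zero =>
    change corollaHom (tree (RTree.node 0)) = _
    simp [corollaHom_node]
  | succ n ih => rw [delta_succ_succ, corollaHom_growth, ih, shift, MvPolynomial.mkDerivation_X]

/-- The Connes-Moscovici generators are algebraically independent. -/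
theorem evalDelta_injective : Function.Injective (evalDelta (K := K)) := by
  -- `corollaHom` is a left inverse: only the corolla in `δₖ₊₁` survives, with coefficient 1.
  have : (corollaHom (K := K)).comp evalDelta = AlgHom.id K _ :=
    MvPolynomial.algHom_ext fun k => by simp [evalDelta, corollaHom_delta]
  exact Function.LeftInverse.injective (g := corollaHom) fun p => DFunLike.congr_fun this p

end ConnesKreimer

/-! ### Coefficients of the antipode polynomials -/

namespace ConnesKreimer
open MvPolynomial (X coeff)

variable {K : Type*} [CommRing K]

/-- The derivation is the infinite sum of the `X (k + 1) ∂/∂X k`. It may be truncated to a finite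
set containing the variables of `p`, and only the `k` with `X (k + 1)` dividing the monomial
contribute. -/
theorem coeff_shift (p : MvPolynomial ℕ K) (m : ℕ →₀ ℕ) (T : Finset ℕ)
    (hT : ∀ k, m (k + 1) ≠ 0 → k ∈ T) :
    coeff m (shift p) = ∑ k ∈ T, if m (k + 1) ≠ 0 then
      coeff (m - Finsupp.single (k + 1) 1 + Finsupp.single k 1) p * (m k + 1) else 0 := by
  classical
  let D : Derivation K (MvPolynomial ℕ K) (MvPolynomial ℕ K) :=
    ∑ k ∈ T ∪ p.vars, (X (k + 1) : MvPolynomial ℕ K) • MvPolynomial.pderiv k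
  have hD : ∀ q, D q = ∑ k ∈ T ∪ p.vars, X (k + 1) * MvPolynomial.pderiv k q := by
    intro q
    change Derivation.coeFnAddMonoidHom D q = _
    simp only [D, map_sum, Finset.sum_apply]
    rfl
  have h : shift p = D p := by
    refine MvPolynomial.derivation_eq_of_forall_mem_vars fun i hi => ?_
    rw [hD, shift, MvPolynomial.mkDerivation_X, Finset.sum_eq_single i]
    · simp
    · intro j _ hj
      simp [MvPolynomial.pderiv_X_of_ne hj.symm]
    · intro h
      exact absurd (Finset.mem_union_right _ hi) h
  rw [h, hD, MvPolynomial.coeff_sum]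
  simp only [MvPolynomial.coeff_X_mul', MvPolynomial.coeff_pderiv, Finsupp.mem_support_iff]
  symm
  refine Finset.sum_subset_zero_on_sdiff Finset.subset_union_left ?_ ?_
  · intro k hk
    rw [if_neg]
    intro h
    exact (Finset.mem_sdiff.1 hk).2 (hT k h)
  · intro k _
    simp

theorem coeff_antipodePoly_succ (n : ℕ) (m : ℕ →₀ ℕ) (T : Finset ℕ)
    (hT : ∀ k, m (k + 1) ≠ 0 → k ∈ T) :
    coeff m (antipodePoly (K := K) (n + 1)) = (∑ k ∈ T, if m (k + 1) ≠ 0 then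
      coeff (m - Finsupp.single (k + 1) 1 + Finsupp.single k 1) (antipodePoly (K := K) n) * (m k + 1)
      else 0) - (n + 1) * if m 0 ≠ 0 then
      coeff (m - Finsupp.single 0 1) (antipodePoly n) else 0 := by
  rw [antipodePoly, MvPolynomial.coeff_sub, coeff_shift _ _ T hT, MvPolynomial.coeff_smul,
    MvPolynomial.coeff_X_mul']
  simp

/-- The weight of a monomial in the Connes-Moscovici generators, `δₖ₊₁` having weight `k + 1`. -/
noncomputable def monWeight : (ℕ →₀ ℕ) →+ ℕ := Finsupp.weight fun k => k + 1

theorem monWeight_single (k c : ℕ) : monWeight (Finsupp.single k c) = c * (k + 1) :=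
  Finsupp.weight_single _ _ _

theorem sub_single_add {m : ℕ →₀ ℕ} {k : ℕ} (h : m k ≠ 0) :
    m - Finsupp.single k 1 + Finsupp.single k 1 = m :=
  tsub_add_cancel_of_le (Finsupp.single_le_iff.2 (Nat.one_le_iff_ne_zero.2 h))

theorem monWeight_sub_single {m : ℕ →₀ ℕ} {k : ℕ} (h : m k ≠ 0) :
    monWeight (m - Finsupp.single k 1) + (k + 1) = monWeight m := by
  conv_rhs => rw [← sub_single_add h, map_add, monWeight_single, one_mul]

theorem degree_sub_single {m : ℕ →₀ ℕ} {k : ℕ} (h : m k ≠ 0) :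
    (m - Finsupp.single k 1).degree + 1 = m.degree := by
  conv_rhs => rw [← sub_single_add h, map_add, Finsupp.degree_single]

/-- Homogeneity: the shift and the multiplication by `X 0` both raise the weight by one. -/
theorem monWeight_eq_of_coeff_ne_zero {n : ℕ} {m : ℕ →₀ ℕ}
    (h : coeff m (antipodePoly (K := K) n) ≠ 0) : monWeight m = n + 1 := by
  classical
  induction n generalizing m with
  | zero =>
    rw [antipodePoly, MvPolynomial.coeff_neg, MvPolynomial.coeff_X] at h
    split_ifs at h with h'
    · rw [← h', monWeight_single, one_mul]
    · simp at h
  | succ n ih =>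
    contrapose! h
    have hT : ∀ k, m (k + 1) ≠ 0 → k ∈ m.support.image (· - 1) := fun k hk =>
      Finset.mem_image.2 ⟨k + 1, by simpa using hk, rfl⟩
    rw [coeff_antipodePoly_succ _ _ _ hT, Finset.sum_eq_zero, zero_sub, neg_eq_zero]
    · split_ifs with h0
      · have hw := monWeight_sub_single h0
        rw [not_imp_comm.1 ih (by omega), mul_zero]
      · rw [mul_zero]
    · intro k _
      split_ifs with hk
      · have hw := monWeight_sub_single hk
        rw [not_imp_comm.1 ih (by rw [map_add, monWeight_single]; omega), zero_mul]
      · rfl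

end ConnesKreimer

/-! ### Recursion for the normalized coefficients -/

namespace ConnesKreimer
open MvPolynomial (X coeff)

variable {K : Type*} [Field K]

/-- The coefficient of `δ₁ ^ a m` in `± S (δₙ₊₁) / n!`, where the exponent `a` is determined by the
weight of the monomial `m` in `δ₂, δ₃, …`. -/
noncomputable def normCoeff (K : Type*) [Field K] (n : ℕ) (m : ℕ →₀ ℕ) : K :=
  if monWeight m ≤ n + 1 then
    (-1) ^ (m.degree + (n + 1 - monWeight m)) *
      coeff (m + Finsupp.single 0 (n + 1 - monWeight m)) (antipodePoly n) / n.factorial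
  else 0

/-- The product with `-(n + 1) δ₁` gives the unchanged term, its sign and factor being absorbed by
the normalization. Replacing `δₖ₊₂` by `δₖ₊₃` gives the sum, and replacing `δ₁` by `δ₂` gives the
last term. Here `r` only bounds the range of the sum. -/
theorem normCoeff_succ [CharZero K] (n r : ℕ) (m : ℕ →₀ ℕ) (h0 : m 0 = 0)
    (hr : ∀ k, m (k + 2) ≠ 0 → k < r) :
    normCoeff K (n + 1) m = normCoeff K n m + ((n : K) + 1)⁻¹ *
      ((∑ k ∈ Finset.range r, if m (k + 2) ≠ 0 then ((m (k + 1) : K) + 1) *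
          normCoeff K n (m - Finsupp.single (k + 2) 1 + Finsupp.single (k + 1) 1) else 0) +
        if m 1 ≠ 0 then ((n : K) + 3 - monWeight m) * normCoeff K n (m - Finsupp.single 1 1)
        else 0) := by
  have hn : (n : K) + 1 ≠ 0 := by exact_mod_cast n.succ_ne_zero
  have hf : (n.factorial : K) ≠ 0 := by exact_mod_cast n.factorial_ne_zero
  have hw : ∀ k, m (k + 2) ≠ 0 →
      monWeight (m - Finsupp.single (k + 2) 1 + Finsupp.single (k + 1) 1) + 1 = monWeight m ∧
      (m - Finsupp.single (k + 2) 1 + Finsupp.single (k + 1) 1).degree = m.degree := by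
    intro k hk
    have h1 := monWeight_sub_single hk
    have h2 := degree_sub_single hk
    rw [map_add, map_add, monWeight_single, Finsupp.degree_single]
    omega
  by_cases hm : monWeight m ≤ n + 2
  · obtain ⟨a, ha⟩ := Nat.exists_eq_add_of_le hm
    have ha' : n + 1 + 1 - monWeight m = a := by omega
    have hT : ∀ k, (m + Finsupp.single 0 a : ℕ →₀ ℕ) (k + 1) ≠ 0 → k ∈ Finset.range (r + 1) := by
      intro k hk
      rcases k with _ | k
      · simp
      · simpa using hr k (by simpa using hk)
    rw [normCoeff, if_pos (by omega), ha', coeff_antipodePoly_succ _ _ _ hT,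
      Finset.sum_range_succ']
    have hS : ∀ k ∈ Finset.range r, (if (m + Finsupp.single 0 a : ℕ →₀ ℕ) (k + 1 + 1) ≠ 0 then
        coeff (m + Finsupp.single 0 a - Finsupp.single (k + 1 + 1) 1 + Finsupp.single (k + 1) 1)
          (antipodePoly (K := K) n) * (((m + Finsupp.single 0 a : ℕ →₀ ℕ) (k + 1) : ℕ) + 1) else 0) =
        (-1) ^ (m.degree + a) * n.factorial * (if m (k + 2) ≠ 0 then ((m (k + 1) : K) + 1) *
          normCoeff K n (m - Finsupp.single (k + 2) 1 + Finsupp.single (k + 1) 1) else 0) := by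
      intro k _
      have e1 : (m + Finsupp.single 0 a : ℕ →₀ ℕ) (k + 1 + 1) = m (k + 2) := by simp
      have e2 : (m + Finsupp.single 0 a : ℕ →₀ ℕ) (k + 1) = m (k + 1) := by simp
      rw [e1, e2]
      split_ifs with hk
      · obtain ⟨h1, h2⟩ := hw k hk
        rw [normCoeff, if_pos (by omega), h2]
        have e3 : n + 1 -
          monWeight (m - Finsupp.single (k + 2) 1 + Finsupp.single (k + 1) 1) = a := by omega
        rw [e3]
        have e4 : m + Finsupp.single 0 a - Finsupp.single (k + 1 + 1) 1 +
            Finsupp.single (k + 1) 1 = m - Finsupp.single (k + 2) 1 + Finsupp.single (k + 1) 1 +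
              Finsupp.single 0 a := by
          ext i
          simp only [Finsupp.add_apply, Finsupp.tsub_apply, Finsupp.single_apply]
          split_ifs <;> omega
        rw [e4]
        field_simp
        rw [← pow_mul, mul_comm _ 2, pow_mul]
        simp
      · simp
    rw [Finset.sum_congr rfl hS, ← Finset.mul_sum]
    -- The source monomial contains `δ₁ ^ (a + 1)`, whose derivative has the factor `a + 1 = n + 3 -
    -- monWeight m`.
    have hS0 : (if (m + Finsupp.single 0 a : ℕ →₀ ℕ) (0 + 1) ≠ 0 then
        coeff (m + Finsupp.single 0 a - Finsupp.single (0 + 1) 1 + Finsupp.single 0 1)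
          (antipodePoly (K := K) n) * (((m + Finsupp.single 0 a : ℕ →₀ ℕ) 0 : ℕ) + 1) else 0) =
        (-1) ^ (m.degree + a) * n.factorial * (if m 1 ≠ 0 then ((n : K) + 3 - monWeight m) *
          normCoeff K n (m - Finsupp.single 1 1) else 0) := by
      have e1 : (m + Finsupp.single 0 a : ℕ →₀ ℕ) (0 + 1) = m 1 := by simp
      have e2 : (m + Finsupp.single 0 a : ℕ →₀ ℕ) 0 = a := by simp [h0]
      rw [e1, e2]
      split_ifs with h1
      · have h2 := monWeight_sub_single h1
        have h3 := degree_sub_single h1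
        have e3 : n + 1 - monWeight (m - Finsupp.single 1 1) = a + 1 := by omega
        rw [normCoeff, if_pos (by omega), e3, ← h3]
        have e4 : m + Finsupp.single 0 a - Finsupp.single (0 + 1) 1 + Finsupp.single 0 1 =
            m - Finsupp.single 1 1 + Finsupp.single 0 (a + 1) := by
          ext i
          simp only [Finsupp.add_apply, Finsupp.tsub_apply, Finsupp.single_apply]
          split_ifs <;> omega
        have e5 : (n : K) + 3 - monWeight m = a + 1 := by
          have : (n : K) + 2 = monWeight m + a := by exact_mod_cast ha
          linear_combination this
        rw [e4, e5, add_assoc (Finsupp.degree _) 1 a, add_comm 1 a]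
        field_simp
        rw [← pow_mul, mul_comm _ 2, pow_mul]
        simp
      · simp
    rw [hS0]
    have hlast : (if (m + Finsupp.single 0 a : ℕ →₀ ℕ) 0 ≠ 0 then
        coeff (m + Finsupp.single 0 a - Finsupp.single 0 1) (antipodePoly (K := K) n) else 0) =
        - ((-1) ^ (m.degree + a) * n.factorial * normCoeff K n m) := by
      have e2 : (m + Finsupp.single 0 a : ℕ →₀ ℕ) 0 = a := by simp [h0]
      rw [e2]
      -- If `a = 0`, no `δ₁` can be removed; on the other side `monWeight m = n + 2` exceeds `n +
      -- 1`, so `normCoeff K n m` is zero by convention.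
      rcases a with _ | a
      · rw [if_neg (by simp), normCoeff, if_neg (by omega)]
        simp
      · have e3 : n + 1 - monWeight m = a := by omega
        have e4 : m + Finsupp.single 0 (a + 1) - Finsupp.single 0 1 = m + Finsupp.single 0 a := by
          ext i
          simp only [Finsupp.add_apply, Finsupp.tsub_apply, Finsupp.single_apply]
          split_ifs <;> omega
        rw [if_pos (by simp), normCoeff, if_pos (by omega), e3, e4]
        have hs : ((-1 : K) ^ (m.degree + a)) * (-1) ^ (m.degree + a) = 1 := by
          rw [← pow_add, ← two_mul, pow_mul]; simp
        rw [← add_assoc, pow_succ]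
        field_simp
        linear_combination -coeff (m + Finsupp.single 0 a) (antipodePoly (K := K) n) * hs
    rw [hlast, Nat.factorial_succ]
    push_cast
    have hs : ((-1 : K) ^ (m.degree + a)) * (-1) ^ (m.degree + a) = 1 := by
      rw [← pow_add, ← two_mul, pow_mul]; simp
    generalize (-1 : K) ^ (m.degree + a) = s at hs ⊢
    generalize (∑ k ∈ Finset.range r, if m (k + 2) ≠ 0 then ((m (k + 1) : K) + 1) *
          normCoeff K n (m - Finsupp.single (k + 2) 1 + Finsupp.single (k + 1) 1) else 0) = A
    generalize (if m 1 ≠ 0 then ((n : K) + 3 - monWeight m) *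
          normCoeff K n (m - Finsupp.single 1 1) else 0) = B
    field_simp
    linear_combination (A + B + (n + 1) * normCoeff K n m) * hs
  · rw [normCoeff, if_neg (by omega), normCoeff, if_neg (by omega), Finset.sum_eq_zero, zero_add,
      zero_add]
    · split_ifs with h1
      · have h2 := monWeight_sub_single h1
        -- In this borderline case `normCoeff` at `m - Finsupp.single 1 1` need not vanish, but its
        -- factor does.
        by_cases h3 : monWeight m = n + 3
        · rw [h3]
          push_cast
          rw [sub_self, zero_mul, mul_zero]
        · rw [normCoeff, if_neg (by omega), mul_zero, mul_zero]
      · rw [mul_zero]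
    · intro k _
      split_ifs with hk
      · have := hw k hk
        rw [normCoeff, if_neg (by omega), mul_zero]
      · rfl

theorem normCoeff_zero_of_one_lt {m : ℕ →₀ ℕ} (h : 1 < monWeight m) : normCoeff K 0 m = 0 := by
  rw [normCoeff, if_neg (by omega)]

theorem normCoeff_one [CharZero K] (n : ℕ) : normCoeff K n 0 = 1 := by
  induction n with
  | zero => simp [normCoeff, antipodePoly]
  | succ n ih =>
    rw [normCoeff_succ n 0 0 rfl (by simp), ih]
    simp

/-- The increment is `(n + 1)⁻¹ (n + 3 - 2) = 1`. The monomial `δ₂` has weight zero in the sense of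
the theorem, and both sequences of weight one reduce to it. -/
theorem normCoeff_single_one [CharZero K] (n : ℕ) : normCoeff K n (Finsupp.single 1 1) = n := by
  induction n with
  | zero =>
    rw [normCoeff_zero_of_one_lt (by rw [monWeight_single]; norm_num), Nat.cast_zero]
  | succ n ih =>
    have hn : (n : K) + 1 ≠ 0 := by exact_mod_cast n.succ_ne_zero
    rw [normCoeff_succ n 0 _ (by simp) (by simp), ih]
    simp only [Finset.range_zero, Finset.sum_empty, Finsupp.single_eq_same, monWeight_single,
      tsub_self, normCoeff_one]
    push_cast
    simp
    field_simp
    ring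

end ConnesKreimer

/-! ### Exponent sequences and their weight -/

namespace ConnesKreimer
open MvPolynomial (X coeff)

/-- The monomial with exponents `(i₂, …, iₙ)` in `δ₂, …, δₙ`. -/
def listMon (l : List ℕ) : ℕ →₀ ℕ := (0 :: l).toFinsupp

theorem listMon_zero (l : List ℕ) : listMon l 0 = 0 := rfl

theorem listMon_succ (l : List ℕ) (k : ℕ) : listMon l (k + 1) = l.getD k 0 := by
  simp [listMon]

theorem getD_dominant (l : List ℕ) (k : ℕ) : (dominant l).getD k 0 = l.getD k 0 := by
  induction l using List.reverseRecOn with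
  | nil => rfl
  | append_singleton l x ih =>
    rw [dominant]
    by_cases hx : x = 0
    · rw [List.rdropWhile_concat_pos _ _ _ (by simpa using hx), ← dominant, ih, hx]
      rcases lt_trichotomy k l.length with h | h | h
      · rw [List.getD_append _ _ _ _ h]
      · rw [List.getD_append_right _ _ _ _ h.ge, List.getD_eq_default _ _ h.ge, h]
        simp
      · rw [List.getD_append_right _ _ _ _ h.le, List.getD_eq_default _ _ h.le,
          List.getD_eq_default]
        simp only [List.length_singleton]
        omega
    · rw [List.rdropWhile_concat_neg _ _ _ (by simpa using hx)]

theorem dominant_dominant (l : List ℕ) : dominant (dominant l) = dominant l :=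
  List.rdropWhile_idempotent _ _

theorem listMon_dominant (l : List ℕ) : listMon (dominant l) = listMon l := by
  ext k
  rcases k with _ | k
  · rfl
  · rw [listMon_succ, listMon_succ, getD_dominant]

theorem lt_length_of_getD_ne_zero {l : List ℕ} {k : ℕ} (h : l.getD k 0 ≠ 0) : k < l.length := by
  by_contra h'
  exact h (List.getD_eq_default _ _ (not_lt.1 h'))

/-- Two gradings are in use: `δⱼ` has weight j in `monWeight`, and j - 1 in the weight of the
theorem. -/
theorem weight_listMon (w : ℕ → ℕ) (l : List ℕ) : Finsupp.weight w (listMon l) =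
    ∑ k ∈ Finset.range l.length, w (k + 1) * l.getD k 0 := by
  rw [Finsupp.weight_apply, Finsupp.sum_of_support_subset _ (s := Finset.range (l.length + 1)),
    Finset.sum_range_succ']
  · simp only [listMon_succ, listMon_zero, smul_eq_mul, mul_comm, zero_mul, add_zero]
  · exact List.toFinsupp_support_subset _
  · simp

theorem weight_eq (l : List ℕ) : weight l = (Finsupp.weight (fun k => k) (listMon l) : ℕ) - 1 := by
  rw [weight, weight_listMon]
  push_cast
  rfl

theorem weight_dominant (l : List ℕ) : weight (dominant l) = weight l := by
  rw [weight_eq, weight_eq, listMon_dominant]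

theorem listMon_set_set {l : List ℕ} {k : ℕ} (h : l.getD (k + 1) 0 ≠ 0) :
    listMon ((l.set k (l.getD k 0 + 1)).set (k + 1) (l.getD (k + 1) 0 - 1)) =
      listMon l - Finsupp.single (k + 2) 1 + Finsupp.single (k + 1) 1 := by
  have hk := lt_length_of_getD_ne_zero h
  ext i
  rcases i with _ | i
  · simp [listMon_zero]
  · simp only [listMon_succ, Finsupp.add_apply, Finsupp.tsub_apply, Finsupp.single_apply,
      List.getD_eq_getElem?_getD, List.getElem?_set, List.length_set]
    grind

theorem listMon_set_zero {l : List ℕ} (h : l.getD 0 0 ≠ 0) :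
    listMon (l.set 0 (l.getD 0 0 - 1)) = listMon l - Finsupp.single 1 1 := by
  have hk := lt_length_of_getD_ne_zero h
  ext i
  rcases i with _ | i
  · simp [listMon_zero]
  · simp only [listMon_succ, Finsupp.tsub_apply, Finsupp.single_apply,
      List.getD_eq_getElem?_getD, List.getElem?_set]
    grind

/-- With `weight_set_zero`, this shows that each step of the recursion for P lowers the weight by
exactly one, which allows induction on N. -/
theorem weight_set_set {l : List ℕ} {k : ℕ} (h : l.getD (k + 1) 0 ≠ 0) :
    weight ((l.set k (l.getD k 0 + 1)).set (k + 1) (l.getD (k + 1) 0 - 1)) + 1 = weight l := by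
  rw [← listMon_succ] at h
  have : Finsupp.weight (fun k => k) (listMon l - Finsupp.single (k + 2) 1) + (k + 2) =
    Finsupp.weight (fun k => k) (listMon l) := Finsupp.weight_sub_single_add h
  rw [listMon_succ] at h
  rw [weight_eq, weight_eq, listMon_set_set h, map_add, Finsupp.weight_single]
  simp only [smul_eq_mul]
  omega

theorem weight_set_zero {l : List ℕ} (h : l.getD 0 0 ≠ 0) :
    weight (l.set 0 (l.getD 0 0 - 1)) + 1 = weight l := by
  rw [← listMon_succ] at h
  have : Finsupp.weight (fun k => k) (listMon l - Finsupp.single 1 1) + 1 =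
    Finsupp.weight (fun k => k) (listMon l) := Finsupp.weight_sub_single_add h
  rw [listMon_succ] at h
  rw [weight_eq, weight_eq, listMon_set_zero h]
  omega

theorem eq_of_dominant_of_weight_one {l : List ℕ} (hl : dominant l = l) (hw : weight l = 1) :
    l = [2] ∨ l = [0, 1] := by
  have hlast := List.rdropWhile_eq_self_iff.1 hl
  rw [weight] at hw
  rcases l with _ | ⟨a, _ | ⟨b, _ | ⟨c, l⟩⟩⟩
  · simp at hw
  · simp at hw
    left
    have : a = 2 := by omega
    rw [this]
  · simp [Finset.sum_range_succ] at hw hlast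
    right
    have h1 : a = 0 := by omega
    have h2 : b = 1 := by omega
    rw [h1, h2]
  -- The nonzero last entry is multiplied by the length, at least 3, whereas the whole sum is 2.
  · exfalso
    have h3 : 3 ≤ (a :: b :: c :: l).length := by simp
    generalize a :: b :: c :: l = L at *
    have h0 := hlast (by rintro rfl; simp at h3)
    rw [List.getLast_eq_getElem] at h0
    have h2 : (1 : ℤ) ≤ L.getD (L.length - 1) 0 := by
      rw [List.getD_eq_getElem _ _ (by omega)]
      rw [decide_eq_true_eq] at h0
      omega
    have h1 := Finset.single_le_sum (f := fun k : ℕ => ((k : ℤ) + 1) * L.getD k 0)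
      (fun k _ => by positivity) (Finset.mem_range.2 (show L.length - 1 < L.length by omega))
    have h3 : (2 : ℤ) ≤ ((L.length - 1 : ℕ) : ℤ) := by omega
    nlinarith

/-! ### Iterated sums and their comparison with the coefficients -/

theorem sum_increasingTuples_succ {M : Type*} [AddCommMonoid M] (N n : ℕ)
    (f : (Fin (N + 1) → ℕ) → M) :
    ∑ p ∈ increasingTuples (N + 1) (n + 1), f p = ∑ p ∈ increasingTuples (N + 1) n, f p +
      ∑ p ∈ increasingTuples N n, f (Fin.snoc p (n + 1)) := by
  classical
  rw [← Finset.sum_filter_not_add_sum_filter _ (fun p => p (Fin.last N) = n + 1)]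
  congr 1
  · refine Finset.sum_congr ?_ fun _ _ => rfl
    ext p
    simp only [Finset.mem_filter, mem_increasingTuples]
    constructor
    · rintro ⟨⟨h1, h2⟩, h3⟩
      have := (h1 (Fin.last N)).2
      exact ⟨fun k => ⟨(h1 k).1, (h2.monotone (Fin.le_last k)).trans (by omega)⟩, h2⟩
    · rintro ⟨h1, h2⟩
      have := (h1 (Fin.last N)).2
      exact ⟨⟨fun k => ⟨(h1 k).1, (h1 k).2.trans n.le_succ⟩, h2⟩, by omega⟩
  · symm
    refine Finset.sum_bij' (fun p _ => Fin.snoc (α := fun _ => ℕ) p (n + 1))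
      (fun p _ => Fin.init p) ?_ ?_ ?_ ?_ ?_
    · intro p hp
      rw [mem_increasingTuples] at hp
      rw [Finset.mem_filter, mem_increasingTuples]
      refine ⟨⟨fun k => ?_, fun i j hij => ?_⟩, Fin.snoc_last _ _⟩
      · induction k using Fin.lastCases with
        | last => simp
        | cast k =>
          rw [Fin.snoc_castSucc]
          exact ⟨(hp.1 k).1, (hp.1 k).2.trans n.le_succ⟩
      · induction i using Fin.lastCases with
        | last => exact absurd hij (not_lt.2 (Fin.le_last _))
        | cast i =>
          induction j using Fin.lastCases with
          | last =>
            rw [Fin.snoc_castSucc, Fin.snoc_last]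
            exact Nat.lt_succ_of_le (hp.1 i).2
          | cast j =>
            rw [Fin.snoc_castSucc, Fin.snoc_castSucc]
            exact hp.2 (by simpa using hij)
    · intro p hp
      rw [Finset.mem_filter, mem_increasingTuples] at hp
      rw [mem_increasingTuples]
      refine ⟨fun k => ⟨(hp.1.1 _).1, ?_⟩, fun i j hij => hp.1.2 (by simpa using hij)⟩
      have := hp.1.2 (Fin.castSucc_lt_last k)
      rw [hp.2] at this
      exact Nat.le_of_lt_succ this
    · intro p _
      exact Fin.init_snoc _ _
    · intro p hp
      rw [Finset.mem_filter] at hp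
      exact (congrArg (Fin.snoc (α := fun _ => ℕ) (Fin.init p)) hp.2.symm).trans
        (Fin.snoc_init_self _)
    · intro p _
      rfl

theorem increasingTuples_succ_zero (N : ℕ) : increasingTuples (N + 1) 0 = ∅ := by
  refine Finset.eq_empty_of_forall_notMem fun p hp => ?_
  have := (mem_increasingTuples.1 hp).1 0
  omega

section
variable {K : Type*} [Field K]

/-- The sum over increasing tuples which gives the coefficients of the antipode. -/
noncomputable def iterSum (K : Type*) [Field K] (N : ℕ) (l : List ℕ) (n : ℕ) : K :=
  ∑ p ∈ increasingTuples N n,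
    MvPolynomial.aeval (fun k => (p k : K)) (iterPoly N l) / ∏ k, (p k : K)

theorem iterSum_succ_zero (N : ℕ) (l : List ℕ) : iterSum K (N + 1) l 0 = 0 := by
  rw [iterSum, increasingTuples_succ_zero, Finset.sum_empty]

theorem iterSum_one_succ (l : List ℕ) (n : ℕ) : iterSum K 1 l (n + 1) = iterSum K 1 l n +
    MvPolynomial.aeval (fun _ => (n : K) + 1) (iterPoly 1 l) / (n + 1) := by
  have h0 : increasingTuples 0 n = {![]} := by
    ext p
    simp [mem_increasingTuples, Subsingleton.elim p ![], Subsingleton.strictMono]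
  rw [iterSum, sum_increasingTuples_succ, h0, Finset.sum_singleton, iterSum]
  have h1 : ∀ k : Fin 1, (Fin.snoc (α := fun _ => ℕ) (![] : Fin 0 → ℕ) (n + 1) : Fin 1 → ℕ) k =
      n + 1 := by
    intro k
    rw [Subsingleton.elim k (Fin.last 0), Fin.snoc_last]
  simp [h1]

/-- The new tuples are those ending in `n + 1`. There the last variable takes the value `n + 1`, the
denominator contributes `(n + 1)⁻¹`, and the recursion for P involves the other variables only
through polynomials of lower weight. -/
theorem iterSum_succ_succ (N : ℕ) (l : List ℕ) (n : ℕ) :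
    iterSum K (N + 2) l (n + 1) = iterSum K (N + 2) l n + ((n : K) + 1)⁻¹ *
      ((∑ k ∈ Finset.range l.length, if l.getD (k + 1) 0 ≠ 0 then ((l.getD k 0 : K) + 1) *
        iterSum K (N + 1) (dominant ((l.set k (l.getD k 0 + 1)).set (k + 1)
          (l.getD (k + 1) 0 - 1))) n else 0) +
        if l.getD 0 0 ≠ 0 then ((n : K) + 3 - monWeight (listMon l)) *
          iterSum K (N + 1) (dominant (l.set 0 (l.getD 0 0 - 1))) n else 0) := by
  rw [iterSum, sum_increasingTuples_succ, ← iterSum]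
  congr 1
  have key : ∀ p : Fin (N + 1) → ℕ, MvPolynomial.aeval
      (fun k => ((Fin.snoc (α := fun _ => ℕ) p (n + 1) : Fin (N + 2) → ℕ) k : K))
      (iterPoly (N + 2) l) / ∏ k, ((Fin.snoc (α := fun _ => ℕ) p (n + 1) : Fin (N + 2) → ℕ) k : K) =
      ((n : K) + 1)⁻¹ *
      ((∑ k ∈ Finset.range l.length, if l.getD (k + 1) 0 ≠ 0 then ((l.getD k 0 : K) + 1) *
        (MvPolynomial.aeval (fun k => (p k : K)) (iterPoly (N + 1) (dominant
          ((l.set k (l.getD k 0 + 1)).set (k + 1) (l.getD (k + 1) 0 - 1)))) / ∏ k, (p k : K))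
          else 0) +
        if l.getD 0 0 ≠ 0 then ((n : K) + 3 - monWeight (listMon l)) *
          (MvPolynomial.aeval (fun k => (p k : K))
            (iterPoly (N + 1) (dominant (l.set 0 (l.getD 0 0 - 1)))) / ∏ k, (p k : K)) else 0) := by
    intro p
    have hW : (monWeight (listMon l) : K) =
        ∑ k ∈ Finset.range l.length, ((k : K) + 2) * l.getD k 0 := by
      rw [monWeight, weight_listMon]
      push_cast
      exact Finset.sum_congr rfl fun k _ => by ring
    have hc : (fun k => ((Fin.snoc (α := fun _ => ℕ) p (n + 1) : Fin (N + 2) → ℕ) k : K)) ∘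
        Fin.castSucc = fun k => (p k : K) := by
      funext k
      rw [Function.comp_apply, Fin.snoc_castSucc]
    rw [Fin.prod_univ_castSucc, iterPoly, map_add, map_sum, Finset.sum_filter]
    simp only [Fin.snoc_castSucc, Fin.snoc_last, map_mul, MvPolynomial.aeval_rename, hc,
      Nat.one_le_iff_ne_zero, apply_ite (MvPolynomial.aeval _), map_zero, map_sub, map_add,
      MvPolynomial.aeval_X, MvPolynomial.aeval_C, hW, map_sum]
    rw [div_eq_mul_inv, mul_inv, ← mul_assoc, mul_comm, add_mul, Finset.sum_mul]
    congr 2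
    · exact Nat.cast_succ n
    · refine Finset.sum_congr rfl fun k _ => ?_
      split_ifs
      · simp [div_eq_mul_inv, mul_assoc]
      · rw [zero_mul]
    · split_ifs
      · simp [div_eq_mul_inv]
        ring
      · rw [zero_mul]
  rw [Finset.sum_congr rfl fun p _ => key p, ← Finset.mul_sum, Finset.sum_add_distrib,
    Finset.sum_comm]
  congr 2
  · refine Finset.sum_congr rfl fun k _ => ?_
    split_ifs
    · rw [iterSum, Finset.mul_sum]
    · rw [Finset.sum_const_zero]
  · split_ifs
    · rw [iterSum, Finset.mul_sum]
    · rw [Finset.sum_const_zero]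

/-- Used to make the coefficients vanish at `n = 0`, where the iterated sums are empty. -/
theorem monWeight_listMon_of_weight {l : List ℕ} {N : ℕ} (h : weight l = N) :
    N < monWeight (listMon l) := by
  rw [weight, sub_eq_iff_eq_add] at h
  rw [monWeight, weight_listMon]
  zify
  rw [Int.lt_iff_add_one_le, ← h]
  exact Finset.sum_le_sum fun k _ => by nlinarith

/-- Both sides vanish at `n = 0` and have the same increments in `n`, by induction on the weight. -/
theorem normCoeff_listMon [CharZero K] {N : ℕ} {l : List ℕ} (hl : dominant l = l)
    (hw : weight l = (N + 1 : ℕ)) (n : ℕ) : normCoeff K n (listMon l) = iterSum K (N + 1) l n := by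
  induction N generalizing l n with
  | zero =>
    induction n with
    | zero =>
      rw [iterSum_succ_zero, normCoeff_zero_of_one_lt (monWeight_listMon_of_weight hw)]
    | succ n ih =>
      have hn : (n : K) + 1 ≠ 0 := by exact_mod_cast n.succ_ne_zero
      rw [iterSum_one_succ, ← ih]
      -- For `δ₂ ^ 2` and `δ₃` the increments, with p = n + 1, are (p - 2)(p - 1)/p and (p - 1)/p:
      -- this is the origin of the two initial polynomials.
      rcases eq_of_dominant_of_weight_one hl (by simpa using hw) with rfl | rfl
      · have e : listMon [2] = Finsupp.single 1 2 := by
          ext i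
          rcases i with _ | _ | i <;> simp [listMon_zero, listMon_succ]
        have e' : (Finsupp.single 1 2 - Finsupp.single 1 1 : ℕ →₀ ℕ) = Finsupp.single 1 1 := by
          rw [← Finsupp.single_tsub]
        rw [e, normCoeff_succ n 0 _ (by simp) (by simp), e', normCoeff_single_one,
          monWeight_single]
        simp [iterPoly]
        field_simp
        ring
      · have e : listMon [0, 1] = Finsupp.single 2 1 := by
          ext i
          rcases i with _ | _ | _ | i <;> simp [listMon_zero, listMon_succ]
        rw [e, normCoeff_succ n 1 _ (by simp) (by intro k; simp [Finsupp.single_apply])]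
        simp [iterPoly, normCoeff_single_one]
        field_simp
  | succ N ihN =>
    induction n with
    | zero =>
      rw [iterSum_succ_zero, normCoeff_zero_of_one_lt]
      have := monWeight_listMon_of_weight hw
      omega
    | succ n ih =>
      have hr : ∀ k, listMon l (k + 2) ≠ 0 → k < l.length := by
        intro k hk
        rw [listMon_succ] at hk
        have := lt_length_of_getD_ne_zero hk
        omega
      rw [iterSum_succ_succ, ← ih, normCoeff_succ n l.length _ (listMon_zero l) hr]
      congr 3
      · refine Finset.sum_congr rfl fun k _ => ?_
        simp only [listMon_succ]
        split_ifs with hk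
        · rw [← ihN (dominant_dominant _), listMon_dominant, listMon_set_set hk]
          have := weight_set_set hk
          rw [weight_dominant]
          push_cast at hw ⊢
          linarith
        · rfl
      · have e : listMon l 1 = l.getD 0 0 := listMon_succ l 0
        rw [e]
        split_ifs with hk
        · rw [← ihN (dominant_dominant _), listMon_dominant, listMon_set_zero hk]
          have := weight_set_zero hk
          rw [weight_dominant]
          push_cast at hw ⊢
          linarith
        · rfl

end
end ConnesKreimer

/-! ### Existence, uniqueness and value of the coefficients -/

namespace ConnesKreimer
open MvPolynomial (X coeff monomial)

/-- The monomial with exponents `(i₁, …, iₙ)` in `δ₁, …, δₙ`. -/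
def indexMon {n : ℕ} (i : Fin n → ℕ) : ℕ →₀ ℕ := (List.ofFn i).toFinsupp

theorem indexMon_apply {n : ℕ} (i : Fin n → ℕ) (j : Fin n) : indexMon i j = i j := by
  simp [indexMon]

theorem indexMon_apply_of_le {n : ℕ} (i : Fin n → ℕ) {k : ℕ} (hk : n ≤ k) : indexMon i k = 0 :=
  List.toFinsupp_apply_le _ _ (by simpa using hk)

theorem indexMon_injective (n : ℕ) : Function.Injective (indexMon (n := n)) := by
  intro i i' h
  funext j
  rw [← indexMon_apply i, h, indexMon_apply]

theorem indexMon_restrict {n : ℕ} {m : ℕ →₀ ℕ} (hm : ∀ k, n ≤ k → m k = 0) :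
    indexMon (fun j : Fin n => m j) = m := by
  ext k
  by_cases hk : k < n
  · exact indexMon_apply _ ⟨k, hk⟩
  · rw [indexMon_apply_of_le _ (not_lt.1 hk), hm k (not_lt.1 hk)]

theorem prod_indexMon {M : Type*} [CommMonoid M] {n : ℕ} (i : Fin n → ℕ) (f : ℕ → ℕ → M)
    (hf : ∀ k, f k 0 = 1) : (indexMon i).prod f = ∏ j : Fin n, f j (i j) := by
  rw [Finsupp.prod_of_support_subset (s := Finset.range n) _ _ _ fun k _ => hf k,
    Finset.prod_range]
  · simp only [indexMon_apply]
  · intro k hk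
    rw [Finset.mem_range]
    by_contra h
    exact (Finsupp.mem_support_iff.1 hk) (indexMon_apply_of_le i (not_lt.1 h))

theorem weight_indexMon {n : ℕ} (w : ℕ → ℕ) (i : Fin n → ℕ) :
    Finsupp.weight w (indexMon i) = ∑ j : Fin n, w j * i j := by
  rw [Finsupp.weight_apply]
  have := prod_indexMon (M := Multiplicative ℕ) i (fun k c => Multiplicative.ofAdd (c • w k))
    (by simp)
  refine (congrArg Multiplicative.toAdd this).trans ?_
  rw [toAdd_prod]
  simp [mul_comm]

theorem monWeight_indexMon {n : ℕ} (i : cmIndices n) : monWeight (indexMon i.1) = n := by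
  rw [monWeight, weight_indexMon]
  exact mem_cmIndices.1 i.2

/-- A monomial of weight n cannot contain a generator of weight greater than n. -/
theorem exists_indexMon_eq {n : ℕ} {m : ℕ →₀ ℕ} (hm : monWeight m = n) :
    ∃ i : cmIndices n, indexMon i.1 = m := by
  have h : indexMon (fun j : Fin n => m j) = m := by
    refine indexMon_restrict fun k hk => ?_
    by_contra h
    have := monWeight_sub_single h
    omega
  refine ⟨⟨fun j => m j, mem_cmIndices.2 ?_⟩, h⟩
  rw [monWeight, ← h, weight_indexMon] at hm
  exact hm

theorem evalDelta_monomial {K : Type*} [CommRing K] {n : ℕ} (i : Fin n → ℕ) (c : K) :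
    evalDelta (monomial (indexMon i) c) = c • ∏ j : Fin n, delta ((j : ℕ) + 1) ^ i j := by
  rw [evalDelta, MvPolynomial.aeval_monomial, prod_indexMon _ _ fun k => pow_zero _,
    Algebra.smul_def]

/-- The coefficients of the antipode in the Connes-Moscovici generators exist and are unique:
they are those of `antipodePoly`. -/
theorem isAntipodeExpansion_iff {K : Type*} [CommRing K] (n : ℕ) (a : cmIndices (n + 1) → K) :
    IsAntipodeExpansion (n + 1) a ↔ ∀ i, a i = coeff (indexMon i.1) (antipodePoly n) := by
  classical
  have h1 : IsAntipodeExpansion (n + 1) a ↔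
      antipodePoly n = ∑ i : cmIndices (n + 1), monomial (indexMon i.1) (a i) := by
    rw [← evalDelta_injective.eq_iff, ← antipodeHom_delta, map_sum]
    simp only [evalDelta_monomial]
    rfl
  have h2 : ∀ i, coeff (indexMon i.1)
      (∑ i : cmIndices (n + 1), monomial (indexMon i.1) (a i)) = a i := by
    intro i
    rw [MvPolynomial.coeff_sum, Finset.sum_eq_single i]
    · rw [MvPolynomial.coeff_monomial, if_pos rfl]
    · intro j _ hj
      rw [MvPolynomial.coeff_monomial, if_neg]
      exact fun h => hj (Subtype.ext (indexMon_injective _ h))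
    · simp
  rw [h1]
  refine ⟨fun h i => by rw [h, h2], fun h => ?_⟩
  ext m
  -- Off weight `n + 1` both polynomials have coefficient zero, by homogeneity.
  by_cases hm : monWeight m = n + 1
  · obtain ⟨i, rfl⟩ := exists_indexMon_eq hm
    rw [h2, h]
  · rw [not_imp_comm.1 monWeight_eq_of_coeff_ne_zero hm, MvPolynomial.coeff_sum,
      Finset.sum_eq_zero]
    intro i _
    rw [MvPolynomial.coeff_monomial, if_neg]
    rintro rfl
    exact hm (monWeight_indexMon i)

theorem indexMon_succ {n : ℕ} (i : Fin (n + 1) → ℕ) :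
    indexMon i = listMon (List.ofFn i).tail + Finsupp.single 0 (i 0) := by
  ext k
  rw [Finsupp.add_apply]
  rcases k with _ | k
  · simp [indexMon, listMon_zero]
  · simp [indexMon, listMon_succ, List.ofFn_succ]

/-- The weight condition on the indices forces `i₁` to be the exponent of `δ₁` built into
`normCoeff`, so this only undoes the normalization. -/
theorem coeff_antipodePoly_indexMon {K : Type*} [Field K] [CharZero K] {n : ℕ}
    (i : cmIndices (n + 1)) : coeff (indexMon i.1) (antipodePoly n) =
      (-1) ^ (∑ j, i.1 j) * (n.factorial : K) * normCoeff K n (listMon (List.ofFn i.1).tail) := by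
  have hf : (n.factorial : K) ≠ 0 := by exact_mod_cast n.factorial_ne_zero
  have hw := monWeight_indexMon i
  have hd : (indexMon i.1).degree = ∑ j, i.1 j := by
    rw [Finsupp.degree_eq_weight_one]
    exact (weight_indexMon (fun _ => 1) i.1).trans (by simp)
  rw [indexMon_succ, map_add, monWeight_single] at hw
  rw [indexMon_succ, map_add, Finsupp.degree_single] at hd
  have e : n + 1 - monWeight (listMon (List.ofFn i.1).tail) = i.1 0 := by omega
  rw [normCoeff, if_pos (by omega), e, hd, indexMon_succ]
  have hs : ((-1 : K) ^ (∑ j, i.1 j)) * (-1) ^ (∑ j, i.1 j) = 1 := by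
    rw [← pow_add, ← two_mul, pow_mul]; simp
  generalize (-1 : K) ^ (∑ j, i.1 j) = s at hs ⊢
  field_simp
  linear_combination
    -coeff (listMon (List.ofFn i.1).tail + Finsupp.single 0 (i.1 0)) (antipodePoly (K := K) n) * hs

end ConnesKreimer

theorem mainTheorem4 (K : Type*) [Field K] [CharZero K] (n : ℕ) (hn : 1 ≤ n) :
    (∃! a : ConnesKreimer.cmIndices n → K, ConnesKreimer.IsAntipodeExpansion n a) ∧
    ∀ a : ConnesKreimer.cmIndices n → K, ConnesKreimer.IsAntipodeExpansion n a →
      ∀ (i : ConnesKreimer.cmIndices n) (N : ℕ), 1 ≤ N → weight (List.ofFn i.1).tail = N →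
        a i = (-1) ^ (∑ j, i.1 j) * ((n - 1).factorial : K) *
          ∑ p ∈ increasingTuples N (n - 1),
            MvPolynomial.aeval (fun k => (p k : K)) (iterPoly N (dominant (List.ofFn i.1).tail)) /
              ∏ k, (p k : K) := by
  obtain ⟨n, rfl⟩ := Nat.exists_eq_add_of_le' hn
  refine ⟨⟨fun i => MvPolynomial.coeff (ConnesKreimer.indexMon i.1)
    (ConnesKreimer.antipodePoly n), ?_, ?_⟩, ?_⟩
  · exact (ConnesKreimer.isAntipodeExpansion_iff n _).2 fun _ => rfl
  · exact fun a ha => funext ((ConnesKreimer.isAntipodeExpansion_iff n a).1 ha)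
  · intro a ha i N hN hw
    obtain ⟨N, rfl⟩ := Nat.exists_eq_add_of_le' hN
    -- Deleting trailing zeros changes neither the monomial nor the weight, so the result for
    -- dominant sequences applies.
    rw [(ConnesKreimer.isAntipodeExpansion_iff n a).1 ha i,
      ConnesKreimer.coeff_antipodePoly_indexMon, ← ConnesKreimer.listMon_dominant,
      ConnesKreimer.normCoeff_listMon (ConnesKreimer.dominant_dominant _)
        ((ConnesKreimer.weight_dominant _).trans hw)]
    rfl
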